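/- **Conventions.** Let $X$ be a proper geodesic metric space with basepoint $p$. A *$(\lambda,\varepsilon)$-quasi-geodesic* is a $(\lambda,\varepsilon)$-quasi-isometric embedding of a closed interval of $\mathbb R$. A *Morse gauge* is a function $N:[1,\infty)\times[0,\infty)\to[0,\infty)$. A geodesic $\gamma$ is *$N$-Morse* if, for $\gamma$ and for each of its subgeodesics $\gamma'$ (segments, rays or lines), every finite $(\lambda,\varepsilon)$-quasi-geodesic with endpoints on $\gamma'$ lies in the closed $N(\lambda,\varepsilon)$-neighbourhood of $\gamma'$. Let $\partial_vX_p$ be the set of geodesic rays based at $p$ modulo finite Hausdorff distance, in which $B$ is closed iff: whenever $\beta_n$ are rays based at $p$ with $[\beta_n]\in B$, $b\in\partial_v X_p$, and every subsequence of $(\beta_n)$ has a subsequence converging uniformly on compact sets to a ray in $b$, then $b\in B$. Let $\partial^N X_p\subseteq\partial_vX_p$ be the subspace of classes containing an $N$-Morse ray based at $p$. The *Morse boundary* is $\partial X=\bigcup_N\partial^NX_p$, with the finest topology making all the inclusions $\partial^NX_p\to\partial X$ continuous. A bi-infinite geodesic is *from $a$ to $b$* ($a,b\in\partial X$) if its negative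 and positive halves are at finite Hausdorff distance from rays representing $a$ and $b$ respectively. A geodesic triangle with vertices $a,b,c\in\partial X$ consists of bi-infinite geodesics between $a$ and $b$, $b$ and $c$, $c$ and $a$. Let $\partial X^{(n,N)}$ be the set of $n$-tuples of pairwise distinct points of $\partial X$ such that every geodesic between two entries is $N$-Morse. A *$K$-center* of $(a,b,c)$ is a point of $X$ within $K$ of all three sides of some geodesic triangle with vertices $a,b,c$; $m^K(a,b,c)$ is the set of these. Call $K\ge 0$ *admissible* for $N$ if every geodesic triangle with vertices in $\partial X$ and $N$-Morse sides has three points, one on each side, at pairwise distance at most $K$. Admissible constants exist; fix the admissible constant $K_N=1+\inf\{K\ge0 : K\text{ admissible for }N\}$ (another choice of admissible constants gives equivalent notions below). For $(a,b,c,d)\in\partial X^{(4,N)}$ put $$[a,b,c,d]_N=\operatorname{diam}\bigl(m^{K_N}(a,b,c)\cup m^{K_N}(a,d,c)\bigr).$$ * $X$ is a *Morse center space* if there are a gauge $N$ and $K>0$ such that every point of $X$ is a $K$-center of some $(a,b,c)\in\partial X^{(3,N)}$. * $X$ has the *small cross-ratio property* if for each $N$ there is $C>0$ such that for all $(a,b,c,d)\in\partial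 X^{(4,N)}$ at least one of $[a,b,c,d]_N$, $[a,c,b,d]_N$, $[b,a,c,d]_N$ is less than $C$. * A map $h:\partial X\to\partial Y$ is *2-stable* if for every $N$ there is $N'$ with $h(\partial X^{(2,N)})\subseteq\partial Y^{(2,N')}$. * A 2-stable map $h$ is *quasi-möbius* if for all $N,N'$ with $h(\partial X^{(2,N)})\subseteq\partial Y^{(2,N')}$ there is a continuous nondecreasing $\psi:[0,\infty)\to[0,\infty)$ such that $[h(a),h(b),h(c),h(d)]_{N'}\le\psi([a,b,c,d]_N)$ for all $(a,b,c,d)\in\partial X^{(4,N)}$. An *HHS structure* on a geodesic metric space is a hierarchically hyperbolic space structure in the sense of Behrstock–Hagen–Sisto (*Hierarchically hyperbolic spaces II*, Definition 1.1): a partially ordered index set $\mathfrak S$ with a unique maximal element, uniformly hyperbolic geodesic spaces $CU$ and coarse projections $\pi_U:X\to 2^{CU}$ for $U\in\mathfrak S$, an orthogonality relation and relative projections $\rho$, satisfying the axioms on projections, nesting, orthogonality, transversality and consistency, finite complexity, large links, bounded geodesic image, partial realization and uniqueness. **Corollary.** Let $X$ and $Y$ be proper geodesic Morse center spaces with the small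 cross-ratio property. Suppose there is a homeomorphism $h:\partial X\to\partial Y$ between their Morse boundaries (with respect to some basepoints) such that $h$ and $h^{-1}$ are 2-stable and quasi-möbius. If $X$ admits an HHS structure, then $Y$ also admits an HHS structure. -/

import Mathlib

open Set Filter Topology
open scoped NNReal

universe u v w z

namespace MorseHHS

section Geodesics

variable {X : Type u} [MetricSpace X]

/-- `γ`, restricted to `I ⊆ ℝ`, is an isometric embedding (values outside `I` are irrelevant). -/
def IsGeodesicOn (γ : ℝ → X) (I : Set ℝ) : Prop :=
  ∀ s ∈ I, ∀ t ∈ I, dist (γ s) (γ t) = |s - t|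

/-- `σ`, restricted to `I ⊆ ℝ`, is an `(l, e)`-quasi-isometric embedding. -/
def IsQuasiGeodesicOn (l e : ℝ) (σ : ℝ → X) (I : Set ℝ) : Prop :=
  ∀ s ∈ I, ∀ t ∈ I, l⁻¹ * |s - t| - e ≤ dist (σ s) (σ t) ∧ dist (σ s) (σ t) ≤ l * |s - t| + e

/-- `s` is the image of a geodesic from `x` to `y`. -/
def IsGeodesicSegment (s : Set X) (x y : X) : Prop :=
  ∃ γ : ℝ → X, IsGeodesicOn γ (Icc 0 (dist x y)) ∧ γ 0 = x ∧ γ (dist x y) = y ∧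
    s = γ '' Icc 0 (dist x y)

variable (X) in
/-- Any two points are joined by a geodesic. -/
def IsGeodesicSpace : Prop := ∀ x y : X, ∃ s : Set X, IsGeodesicSegment s x y

variable (X) in
/-- Geodesic metric space all of whose geodesic triangles are `δ`-slim. The slimness condition is
stated for one side, which covers every side because the vertices may be permuted. -/
structure IsHyperbolic (δ : ℝ) : Prop where
  geodesic : IsGeodesicSpace X
  slim : ∀ (x y z : X) (A B C : Set X), IsGeodesicSegment A x y → IsGeodesicSegment B y z →
    IsGeodesicSegment C z x → ∀ a ∈ A, ∃ b ∈ B ∪ C, dist a b ≤ δ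

/-- Morse gauges: functions `[1, ∞) × [0, ∞) → [0, ∞)`. -/
abbrev MorseGauge : Type := Set.Ici (1 : ℝ) → ℝ≥0 → ℝ≥0

/-- Every finite `(l, e)`-quasi-geodesic with endpoints on `γ(I)` stays in the
`N(l, e)`-neighbourhood of `γ(I)`. -/
def IsMorseOn (N : MorseGauge) (γ : ℝ → X) (I : Set ℝ) : Prop :=
  ∀ (l : Set.Ici (1 : ℝ)) (e : ℝ≥0) (σ : ℝ → X) (a b : ℝ), a ≤ b →
    IsQuasiGeodesicOn (l : ℝ) (e : ℝ) σ (Icc a b) → σ a ∈ γ '' I → σ b ∈ γ '' I →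
    ∀ t ∈ Icc a b, ∃ s ∈ I, dist (σ t) (γ s) ≤ N l e

/-- `N`-Morse geodesics, with the convention that `N` is a Morse gauge for the geodesic and for all
its subgeodesics. -/
def IsMorseGeodesicOn (N : MorseGauge) (γ : ℝ → X) (I : Set ℝ) : Prop :=
  IsGeodesicOn γ I ∧ ∀ J ⊆ I, J.OrdConnected → IsClosed J → IsMorseOn N γ J

/-- Finite Hausdorff distance. -/
def Asymptotic (A B : Set X) : Prop := Metric.hausdorffEDist A B ≠ ⊤

/-- Geodesic rays `[0, ∞) → X` based at `p` (the values at negative reals are irrelevant). -/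
structure GeodesicRay (p : X) where
  toFun : ℝ → X
  geodesic : IsGeodesicOn toFun (Ici 0)
  base : toFun 0 = p

/-- The image of a ray. -/
def GeodesicRay.image {p : X} (α : GeodesicRay p) : Set X := α.toFun '' Ici 0

/-- Two rays are equivalent when they are asymptotic. -/
def raySetoid (p : X) : Setoid (GeodesicRay p) where
  r α β := Asymptotic α.image β.image
  iseqv :=
    { refl := fun α => by simp [Asymptotic]
      symm := fun {α β} h => by
        unfold Asymptotic at *
        rwa [Metric.hausdorffEDist_comm]
      trans := fun {α β γ} h₁ h₂ =>
        ne_top_of_le_ne_top (ENNReal.add_ne_top.2 ⟨h₁, h₂⟩) Metric.hausdorffEDist_triangle }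

/-- The set of asymptotism classes of geodesic rays based at `p`. -/
def VisualBoundary (p : X) : Type u := Quotient (raySetoid p)

/-- The class of a ray. -/
def GeodesicRay.endpoint {p : X} (α : GeodesicRay p) : VisualBoundary p :=
  Quotient.mk (raySetoid p) α

/-- Uniform convergence on compact subsets of `[0, ∞)`. -/
def RaysConverge {p : X} (β : ℕ → GeodesicRay p) (γ : GeodesicRay p) : Prop :=
  ∀ R : ℝ, TendstoUniformlyOn (fun n => (β n).toFun) γ.toFun atTop (Icc 0 R)

/-- Every subsequence of `β` contains a subsequence converging, uniformly on compact sets, to a ray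
in the class `b`. -/
def SubseqConverge {p : X} (β : ℕ → GeodesicRay p) (b : VisualBoundary p) : Prop :=
  ∀ φ : ℕ → ℕ, StrictMono φ → ∃ χ : ℕ → ℕ, StrictMono χ ∧
    ∃ γ : GeodesicRay p, γ.endpoint = b ∧ RaysConverge (fun n => β (φ (χ n))) γ

/-- The sets that are declared closed in the visual boundary. -/
def IsVisuallyClosed {p : X} (B : Set (VisualBoundary p)) : Prop :=
  ∀ (β : ℕ → GeodesicRay p) (b : VisualBoundary p),
    (∀ n, (β n).endpoint ∈ B) → SubseqConverge β b → b ∈ B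

theorem SubseqConverge.comp {p : X} {β : ℕ → GeodesicRay p} {b : VisualBoundary p}
    (h : SubseqConverge β b) {φ : ℕ → ℕ} (hφ : StrictMono φ) :
    SubseqConverge (fun n => β (φ n)) b :=
  fun χ hχ => h (fun n => φ (χ n)) (hφ.comp hχ)

theorem IsVisuallyClosed.union {p : X} {A B : Set (VisualBoundary p)}
    (hA : IsVisuallyClosed A) (hB : IsVisuallyClosed B) : IsVisuallyClosed (A ∪ B) := by
  intro β b hβ hb
  by_cases hf : ∃ᶠ n in atTop, (β n).endpoint ∈ A
  · obtain ⟨φ, hφ, h⟩ := extraction_of_frequently_atTop hf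
    exact Or.inl (hA _ b h (hb.comp hφ))
  · have hf' : ∀ᶠ n in atTop, (β n).endpoint ∈ B := by
      filter_upwards [not_frequently.1 hf] with n hn
      exact (hβ n).resolve_left hn
    obtain ⟨φ, hφ, h⟩ := extraction_of_frequently_atTop hf'.frequently
    exact Or.inr (hB _ b h (hb.comp hφ))

instance (p : X) : TopologicalSpace (VisualBoundary p) :=
  TopologicalSpace.ofClosed {B | IsVisuallyClosed B}
    (fun _ _ hβ _ => (hβ 0).elim)
    (fun _ h β b hβ hb => mem_sInter.2 fun B hB => h hB β b (fun n => mem_sInter.1 (hβ n) B hB) hb)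
    (fun _ hA _ hB => hA.union hB)

/-- The classes containing an `N`-Morse geodesic ray based at `p`. -/
def stratum (p : X) (N : MorseGauge) : Set (VisualBoundary p) :=
  {b | ∃ α : GeodesicRay p, α.endpoint = b ∧ IsMorseGeodesicOn N α.toFun (Ici 0)}

/-- The Morse boundary of `X` at the basepoint `p`: the union of the strata. -/
def MorseBoundary (p : X) : Type u := {b : VisualBoundary p // ∃ N, b ∈ stratum p N}

/-- The inclusion of a stratum in the Morse boundary. -/
def stratumInclusion (p : X) (N : MorseGauge) (b : stratum p N) : MorseBoundary p :=
  ⟨b.1, N, b.2⟩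

/-- The direct limit topology: the finest one for which the inclusions of all the strata, with
their subspace topologies, are continuous. -/
instance (p : X) : TopologicalSpace (MorseBoundary p) :=
  ⨆ N : MorseGauge, TopologicalSpace.coinduced (stratumInclusion p N) inferInstance

end Geodesics

section CrossRatio

variable {X : Type u} [MetricSpace X]

/-- `γ` is a bi-infinite geodesic from `a` to `b`. -/
def IsLineFromTo {p : X} (γ : ℝ → X) (a b : MorseBoundary p) : Prop :=
  IsGeodesicOn γ univ ∧
    (∃ α : GeodesicRay p, α.endpoint = a.1 ∧ Asymptotic (γ '' Iic 0) α.image) ∧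
    (∃ β : GeodesicRay p, β.endpoint = b.1 ∧ Asymptotic (γ '' Ici 0) β.image)

/-- The `n`-tuples of pairwise distinct points of the Morse boundary such that every geodesic
between two entries is `N`-Morse. -/
def morseTuples (p : X) (n : ℕ) (N : MorseGauge) : Set (Fin n → MorseBoundary p) :=
  {x | Function.Injective x ∧ ∀ i j, i ≠ j → ∀ γ : ℝ → X, IsLineFromTo γ (x i) (x j) →
    IsMorseGeodesicOn N γ univ}

/-- `α`, `β`, `γ` are the sides of an ideal geodesic triangle with vertices `a`, `b`, `c`. -/
def IsIdealTriangle {p : X} (α β γ : ℝ → X) (a b c : MorseBoundary p) : Prop :=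
  IsLineFromTo α a b ∧ IsLineFromTo β b c ∧ IsLineFromTo γ c a

/-- The `K`-centers of `(a, b, c)`: points within `K` of all sides of some ideal geodesic triangle
with vertices `a`, `b`, `c`. -/
def centers {p : X} (K : ℝ) (a b c : MorseBoundary p) : Set X :=
  {x | ∃ α β γ : ℝ → X, IsIdealTriangle α β γ a b c ∧
    (∃ t, dist x (α t) ≤ K) ∧ (∃ t, dist x (β t) ≤ K) ∧ (∃ t, dist x (γ t) ≤ K)}

/-- Every ideal geodesic triangle with `N`-Morse sides has a `K`-internal triple: three points, one
on each side, pairwise at distance at most `K`. -/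
def HasInternalTriples (p : X) (N : MorseGauge) (K : ℝ) : Prop :=
  ∀ (a b c : MorseBoundary p) (α β γ : ℝ → X), IsIdealTriangle α β γ a b c →
    IsMorseGeodesicOn N α univ → IsMorseGeodesicOn N β univ → IsMorseGeodesicOn N γ univ →
    ∃ r s t : ℝ, dist (α r) (β s) ≤ K ∧ dist (β s) (γ t) ≤ K ∧ dist (γ t) (α r) ≤ K

/-- A constant `K_N` such that every ideal geodesic triangle with `N`-Morse sides has a
`K_N`-internal triple. Such constants exist in proper geodesic spaces; adding `1` to their infimum
selects one of them. -/
noncomputable def centerConst (p : X) (N : MorseGauge) : ℝ :=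
  sInf {K : ℝ | 0 ≤ K ∧ HasInternalTriples p N K} + 1

/-- The `N`-cross-ratio `[a, b, c, d]_N`. -/
noncomputable def crossRatio {p : X} (N : MorseGauge) (a b c d : MorseBoundary p) : ℝ≥0 :=
  ⟨Metric.diam (centers (centerConst p N) a b c ∪ centers (centerConst p N) a d c),
    Metric.diam_nonneg⟩

/-- Morse center spaces: for some gauge `N` and some `K`, every point is a `K`-center of a triple
in `∂X^(3,N)`. -/
def IsMorseCenterSpace (p : X) : Prop :=
  ∃ (N : MorseGauge) (K : ℝ), 0 < K ∧
    ∀ y : X, ∃ x ∈ morseTuples p 3 N, y ∈ centers K (x 0) (x 1) (x 2)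

/-- The small cross-ratio property. -/
def HasSmallCrossRatio (p : X) : Prop :=
  ∀ N : MorseGauge, ∃ C : ℝ≥0, 0 < C ∧ ∀ x ∈ morseTuples p 4 N,
    crossRatio N (x 0) (x 1) (x 2) (x 3) < C ∨
    crossRatio N (x 0) (x 2) (x 1) (x 3) < C ∨
    crossRatio N (x 1) (x 0) (x 2) (x 3) < C

variable {Y : Type v} [MetricSpace Y]

/-- `h` maps `∂X^(2,N)` into `∂Y^(2,N')`. -/
def MapsPairs {p : X} {q : Y} (h : MorseBoundary p → MorseBoundary q) (N N' : MorseGauge) : Prop :=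
  ∀ x ∈ morseTuples p 2 N, h ∘ x ∈ morseTuples q 2 N'

/-- 2-stable maps. -/
def IsTwoStable {p : X} {q : Y} (h : MorseBoundary p → MorseBoundary q) : Prop :=
  ∀ N : MorseGauge, ∃ N' : MorseGauge, MapsPairs h N N'

/-- The quasi-möbius condition. -/
def IsQuasiMobius {p : X} {q : Y} (h : MorseBoundary p → MorseBoundary q) : Prop :=
  ∀ N N' : MorseGauge, MapsPairs h N N' →
    ∃ ψ : ℝ≥0 → ℝ≥0, Continuous ψ ∧ Monotone ψ ∧ ∀ x ∈ morseTuples p 4 N,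
      crossRatio N' (h (x 0)) (h (x 1)) (h (x 2)) (h (x 3)) ≤
        ψ (crossRatio N (x 0) (x 1) (x 2) (x 3))

end CrossRatio

section HHS

/-- The set `A` has diameter at most `r`. -/
def DiamLE {Z : Type z} [MetricSpace Z] (A : Set Z) (r : ℝ) : Prop :=
  ∀ a ∈ A, ∀ b ∈ A, dist a b ≤ r

/-- The distance `inf {d(a, b) : a ∈ A, b ∈ B}` between two (nonempty) sets. -/
noncomputable def setDist {Z : Type z} [MetricSpace Z] (A B : Set Z) : ℝ :=
  sInf {r : ℝ | ∃ a ∈ A, ∃ b ∈ B, r = dist a b}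

/-- `V` and `W` are transverse: not orthogonal, and neither is nested in the other. -/
def Transverse {I : Type w} [PartialOrder I] (orth : I → I → Prop) (V W : I) : Prop :=
  ¬ orth V W ∧ ¬ V ≤ W ∧ ¬ W ≤ V

/-- A hierarchically hyperbolic space structure on `X` (Behrstock-Hagen-Sisto). Nesting is the
partial order `≤` on the index set; `V < W` is proper nesting. -/
structure HHSStructure (X : Type u) [MetricSpace X] where
  /-- The index set. -/
  Idx : Type w
  [order : PartialOrder Idx]
  /-- The associated hyperbolic spaces. -/
  C : Idx → Type z
  [metric : ∀ U, MetricSpace (C U)]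
  δ : ℝ
  hyperbolic : ∀ U, IsHyperbolic (C U) δ
  -- projections
  /-- The coarse maps `π_W : X → 2^(CW)`. -/
  π : ∀ W, X → Set (C W)
  ξ : ℝ
  K : ℝ
  π_nonempty : ∀ W x, (π W x).Nonempty
  π_diam : ∀ W x, DiamLE (π W x) ξ
  π_lipschitz : ∀ W x y, setDist (π W x) (π W y) ≤ K * dist x y + K
  π_quasiconvex : ∀ W, ∀ a ∈ ⋃ x, π W x, ∀ b ∈ ⋃ x, π W x, ∀ s : Set (C W),
    IsGeodesicSegment s a b → ∀ q ∈ s, ∃ q' ∈ ⋃ x, π W x, dist q q' ≤ K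
  -- nesting
  exists_unique_max : ∃! S : Idx, IsMax S
  -- orthogonality
  orth : Idx → Idx → Prop
  orth_symm : ∀ V W, orth V W → orth W V
  orth_irrefl : ∀ V, ¬ orth V V
  orth_of_le : ∀ U V W, V ≤ W → orth W U → orth V U
  orth_container : ∀ T U, U ≤ T → (∃ V, V ≤ T ∧ orth V U) →
    ∃ W, W < T ∧ ∀ V, V ≤ T → orth V U → V ≤ W
  orth_not_comparable : ∀ V W, orth V W → ¬ V ≤ W ∧ ¬ W ≤ V
  -- relative projections
  /-- `ρset V W` is the set `ρ^V_W ⊆ CW`, meaningful if `V < W` or if `V`, `W` are transverse. -/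
  ρset : Idx → ∀ W, Set (C W)
  /-- `ρmap W V` is the projection `ρ^W_V : CW → 2^(CV)`, meaningful if `V < W`. -/
  ρmap : ∀ W V, C W → Set (C V)
  ρset_nonempty : ∀ V W, V < W ∨ Transverse orth V W → (ρset V W).Nonempty
  ρset_diam : ∀ V W, V < W ∨ Transverse orth V W → DiamLE (ρset V W) ξ
  ρmap_nonempty : ∀ V W, V < W → ∀ q, (ρmap W V q).Nonempty
  -- consistency
  κ₀ : ℝ
  consistency_transverse : ∀ V W, Transverse orth V W → ∀ x,
    min (setDist (π W x) (ρset V W)) (setDist (π V x) (ρset W V)) ≤ κ₀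
  consistency_nested : ∀ V W, V < W → ∀ x,
    setDist (π W x) (ρset V W) ≤ κ₀ ∨ DiamLE (π V x ∪ ⋃ q ∈ π W x, ρmap W V q) κ₀
  consistency_ρ : ∀ U V W, U ≤ V → (V < W ∨ (Transverse orth V W ∧ ¬ orth W U)) →
    setDist (ρset U W) (ρset V W) ≤ κ₀
  -- finite complexity
  complexity : ℕ
  finite_complexity : ∀ s : Set Idx, IsChain (· ≤ ·) s → s.encard ≤ complexity
  -- large links
  lam : ℝ
  one_le_lam : 1 ≤ lam
  E : ℝ
  E_pos : 0 < E
  ξ_le_E : ξ ≤ E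
  κ₀_le_E : κ₀ ≤ E
  large_links : ∀ W x x', ∃ 𝒯 : Finset Idx,
    𝒯.card ≤ ⌊lam * setDist (π W x) (π W x') + lam⌋₊ ∧ (∀ T ∈ 𝒯, T < W) ∧
    (∀ V, V < W → (∃ T ∈ 𝒯, V ≤ T) ∨ setDist (π V x) (π V x') < E) ∧
    ∀ T ∈ 𝒯, setDist (π W x) (ρset T W) ≤ lam * setDist (π W x) (π W x') + lam
  -- bounded geodesic image
  bounded_geodesic_image : ∀ V W, V < W → ∀ (a b : C W) (s : Set (C W)),
    IsGeodesicSegment s a b →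
    DiamLE (⋃ q ∈ s, ρmap W V q) E ∨ ∃ q ∈ s, ∃ r ∈ ρset V W, dist q r ≤ E
  -- partial realization
  α : ℝ
  partial_realization : ∀ (A : Set Idx), A.Pairwise orth → ∀ p : ∀ V, C V,
    (∀ V ∈ A, p V ∈ ⋃ x, π V x) → ∃ x, ∀ V ∈ A,
      setDist (π V x) {p V} ≤ α ∧
      (∀ W, V < W ∨ Transverse orth V W → setDist (π W x) (ρset V W) ≤ α)
  -- uniqueness
  uniqueness : ∀ κ : ℝ, ∃ θ : ℝ, ∀ x y, θ ≤ dist x y → ∃ V, κ ≤ setDist (π V x) (π V y)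

end HHS

end MorseHHS

/-! The boundary map is extended to the interior through centers of ideal triangles. Every point `x`
is a center of some triple of uniformly Morse boundary points; `f x` is chosen to be a center of the
image triple, and `g : Y → X` is built in the same way from `h.symm`. Then `g` is a quasi-isometry,
with coarse inverse `f`, and an HHS structure on `X` pulls back along it by composing the
projections with `g`.

The main point is that `f` is coarsely independent of the triple
(`IsQuasiMobius.exists_centers_bound`). Suppose that `x` is a center of `A` and of `A'`. By slimness
each `A i` fails to be joined to at most one `A' j` by a line passing near `x`, and symmetrically,
so after a permutation (`exists_perm_offDiag`) every `A i` and `A' j` with `i ≠ j` are joined near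
`x`. The vertices can therefore be exchanged one at a time with `x` remaining a center throughout.
Each exchange has bounded cross-ratio, by the diameter bound for centers; the quasi-möbius
inequality bounds the image cross-ratio, hence the distance between the centers of the image
triples.

Since nearby points are centers of the same triples for a larger constant, this also gives control
of `f` at every scale, and `exists_dist_inverse_le` makes `f` and `g` coarsely inverse.

The geometric input concerns Morse geodesics. `exists_spike` turns a quasi-geodesic followed by a
geodesic to an outside point into a quasi-geodesic; it gives closeness estimates depending only on
the gauge (`near_of_ends_near`, `ray_near_of_foot`). These yield slimness of ideal triangles,
uniqueness of centers up to bounded distance, and uniform gauges for lines between ends of Morse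
lines passing near a common point. -/

namespace MorseHHS

/-! ### Morse geodesics: stability estimates and changes of gauge. -/

section MorseGeometry

variable {X : Type u} [MetricSpace X]

/-- The value of a Morse gauge at real parameters. -/
noncomputable def gaugeVal (N : MorseGauge) (l e : ℝ) : ℝ :=
  N ⟨max 1 l, mem_Ici.2 (le_max_left _ _)⟩ e.toNNReal

/-- The Morse gauge with prescribed real values. -/
noncomputable def gaugeOf (F : ℝ → ℝ → ℝ) : MorseGauge := fun l e => (F l e).toNNReal

theorem gaugeVal_nonneg (N : MorseGauge) (l e : ℝ) : 0 ≤ gaugeVal N l e := NNReal.coe_nonneg _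

theorem gaugeVal_eq (N : MorseGauge) (l : Set.Ici (1 : ℝ)) (e : ℝ≥0) :
    gaugeVal N l e = N l e := by
  have h : (⟨max 1 (l : ℝ), mem_Ici.2 (le_max_left _ _)⟩ : Set.Ici (1 : ℝ)) = l :=
    Subtype.ext (max_eq_right l.2)
  simp [gaugeVal, h]

/-- Only an inequality, because `gaugeOf` truncates negative values at zero. -/
theorem le_gaugeVal_gaugeOf (F : ℝ → ℝ → ℝ) {l e : ℝ} (hl : 1 ≤ l) (he : 0 ≤ e) :
    F l e ≤ gaugeVal (gaugeOf F) l e := by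
  simp only [gaugeVal, gaugeOf, max_eq_right hl, Real.coe_toNNReal e he]
  exact Real.le_coe_toNNReal _

theorem gaugeVal_mono {N N' : MorseGauge} (h : N ≤ N') (l e : ℝ) :
    gaugeVal N l e ≤ gaugeVal N' l e := NNReal.coe_le_coe.2 (h _ _)

/-- Working form of the Morse property: quasi-geodesics joining two points of the geodesic stay
close to the segment between them. -/
structure IsMorseGeod (N : MorseGauge) (γ : ℝ → X) (I : Set ℝ) : Prop where
  geodesic : IsGeodesicOn γ I
  ordConnected : I.OrdConnected
  morse : ∀ s ∈ I, ∀ t ∈ I, ∀ (l e : ℝ) (σ : ℝ → X) (a b : ℝ), 1 ≤ l → 0 ≤ e → a ≤ b →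
    IsQuasiGeodesicOn l e σ (Icc a b) → σ a = γ s → σ b = γ t →
    ∀ u ∈ Icc a b, ∃ v ∈ uIcc s t, dist (σ u) (γ v) ≤ gaugeVal N l e

/-- The Morse property is applied to the subgeodesic over `uIcc s t`; this is what confines the
nearby point to that segment. -/
theorem IsMorseGeodesicOn.isMorseGeod {N : MorseGauge} {γ : ℝ → X} {I : Set ℝ}
    (h : IsMorseGeodesicOn N γ I) (hI : I.OrdConnected) : IsMorseGeod N γ I := by
  refine ⟨h.1, hI, ?_⟩
  intro s hs t ht l e σ a b hl he hab hσ ha hb u hu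
  obtain ⟨v, hv, hd⟩ := h.2 (uIcc s t) (hI.uIcc_subset hs ht) ordConnected_uIcc isClosed_Icc
    ⟨l, hl⟩ ⟨e, he⟩ σ a b hab hσ (ha ▸ mem_image_of_mem _ left_mem_uIcc)
    (hb ▸ mem_image_of_mem _ right_mem_uIcc) u hu
  exact ⟨v, hv, hd.trans_eq (gaugeVal_eq N ⟨l, hl⟩ ⟨e, he⟩).symm⟩

theorem IsMorseGeod.isMorseGeodesicOn {N : MorseGauge} {γ : ℝ → X} {I : Set ℝ}
    (h : IsMorseGeod N γ I) : IsMorseGeodesicOn N γ I := by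
  refine ⟨h.geodesic, ?_⟩
  rintro J hJ hJo - l e σ a b hab hσ ⟨s, hs, hs'⟩ ⟨t, ht, ht'⟩ u hu
  obtain ⟨v, hv, hd⟩ := h.morse s (hJ hs) t (hJ ht) l e σ a b l.2 e.2 hab hσ hs'.symm ht'.symm u hu
  exact ⟨v, hJo.uIcc_subset hs ht hv, by rwa [gaugeVal_eq] at hd⟩

theorem isMorseGeodesicOn_univ_iff {N : MorseGauge} {γ : ℝ → X} :
    IsMorseGeodesicOn N γ univ ↔ IsMorseGeod N γ univ :=
  ⟨fun h => h.isMorseGeod ordConnected_univ, fun h => h.isMorseGeodesicOn⟩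

theorem IsMorseGeod.mono_gauge {N N' : MorseGauge} {γ : ℝ → X} {I : Set ℝ}
    (h : IsMorseGeod N γ I) (hN : N ≤ N') : IsMorseGeod N' γ I :=
  ⟨h.geodesic, h.ordConnected, fun s hs t ht l e σ a b hl he hab hσ ha hb u hu => by
    obtain ⟨v, hv, hd⟩ := h.morse s hs t ht l e σ a b hl he hab hσ ha hb u hu
    exact ⟨v, hv, hd.trans (gaugeVal_mono hN _ _)⟩⟩

theorem IsGeodesicOn.mono {γ : ℝ → X} {I J : Set ℝ} (h : IsGeodesicOn γ I) (hJ : J ⊆ I) :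
    IsGeodesicOn γ J := fun s hs t ht => h s (hJ hs) t (hJ ht)

theorem IsGeodesicOn.comp {γ : ℝ → X} {I J : Set ℝ} (h : IsGeodesicOn γ I) {f : ℝ → ℝ}
    (hf : MapsTo f J I) (hd : ∀ s t, |f s - f t| = |s - t|) : IsGeodesicOn (fun t => γ (f t)) J :=
  fun s hs t ht => (h _ (hf hs) _ (hf ht)).trans (hd s t)

theorem IsMorseGeod.mono {N : MorseGauge} {γ : ℝ → X} {I J : Set ℝ}
    (h : IsMorseGeod N γ I) (hJ : J ⊆ I) (hJo : J.OrdConnected) : IsMorseGeod N γ J :=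
  ⟨h.geodesic.mono hJ, hJo, fun s hs t ht => h.morse s (hJ hs) t (hJ ht)⟩

theorem IsMorseGeod.comp_neg {N : MorseGauge} {γ : ℝ → X} (h : IsMorseGeod N γ univ) :
    IsMorseGeod N (fun t => γ (-t)) univ := by
  refine ⟨h.geodesic.comp (fun _ _ => mem_univ _) fun s t => ?_, ordConnected_univ, ?_⟩
  · rw [← abs_neg]; congr 1; ring
  · intro s _ t _ l e σ a b hl he hab hσ ha hb u hu
    obtain ⟨v, hv, hd⟩ := h.morse (-s) trivial (-t) trivial l e σ a b hl he hab hσ ha hb u hu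
    refine ⟨-v, ?_, by simpa using hd⟩
    rw [mem_uIcc] at hv ⊢
    rcases hv with hv | hv
    · exact Or.inr ⟨by linarith [hv.2], by linarith [hv.1]⟩
    · exact Or.inl ⟨by linarith [hv.2], by linarith [hv.1]⟩

theorem IsGeodesicOn.isQuasiGeodesicOn {γ : ℝ → X} {I : Set ℝ} (h : IsGeodesicOn γ I) :
    IsQuasiGeodesicOn 1 0 γ I := fun s hs t ht => by simp [h s hs t ht]

theorem IsQuasiGeodesicOn.mono {l e : ℝ} {σ : ℝ → X} {I J : Set ℝ}
    (h : IsQuasiGeodesicOn l e σ I) (hJ : J ⊆ I) : IsQuasiGeodesicOn l e σ J :=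
  fun s hs t ht => h s (hJ hs) t (hJ ht)

theorem IsQuasiGeodesicOn.perturb {l e D : ℝ} {σ τ : ℝ → X} {I : Set ℝ}
    (h : IsQuasiGeodesicOn l e σ I) (hτ : ∀ t ∈ I, dist (τ t) (σ t) ≤ D) :
    IsQuasiGeodesicOn l (e + 2 * D) τ I := by
  intro s hs t ht
  have h1 := hτ s hs
  have h2 := hτ t ht
  obtain ⟨h3, h4⟩ := h s hs t ht
  have h5 := dist_triangle4 (τ s) (σ s) (σ t) (τ t)
  have h6 := dist_triangle4 (σ s) (τ s) (τ t) (σ t)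
  rw [dist_comm (σ t) (τ t)] at h5
  rw [dist_comm (σ s) (τ s)] at h6
  constructor <;> linarith

theorem IsQuasiGeodesicOn.reverse {l e a b : ℝ} {σ : ℝ → X}
    (h : IsQuasiGeodesicOn l e σ (Icc a b)) :
    IsQuasiGeodesicOn l e (fun t => σ (-t)) (Icc (-b) (-a)) := by
  intro s hs t ht
  have := h (-s) ⟨by linarith [hs.2], by linarith [hs.1]⟩ (-t) ⟨by linarith [ht.2], by linarith [ht.1]⟩
  rwa [show |(-s) - (-t)| = |s - t| by rw [← abs_neg]; congr 1; ring] at this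

/-- Moving the two endpoints of `σ` onto `η` costs only `2 * D` in the additive constant, since
quasi-geodesics are not required to be continuous. -/
theorem IsMorseGeod.near {N : MorseGauge} {η : ℝ → X} {I : Set ℝ} (hη : IsMorseGeod N η I)
    {l e D a b s₁ s₂ : ℝ} {σ : ℝ → X} (hl : 1 ≤ l) (he : 0 ≤ e)
    (hs₁ : s₁ ∈ I) (hs₂ : s₂ ∈ I) (hab : a ≤ b) (hσ : IsQuasiGeodesicOn l e σ (Icc a b))
    (h₁ : dist (σ a) (η s₁) ≤ D) (h₂ : dist (σ b) (η s₂) ≤ D) :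
    ∀ t ∈ Icc a b, ∃ s ∈ uIcc s₁ s₂, dist (σ t) (η s) ≤ gaugeVal N l (e + 2 * D) + D := by
  intro t ht
  have hD : 0 ≤ D := dist_nonneg.trans h₁
  have hN := gaugeVal_nonneg N l (e + 2 * D)
  by_cases hta : t = a
  · exact ⟨s₁, left_mem_uIcc, by rw [hta]; linarith⟩
  by_cases htb : t = b
  · exact ⟨s₂, right_mem_uIcc, by rw [htb]; linarith⟩
  have hba : b ≠ a := by
    rintro rfl
    exact hta (le_antisymm ht.2 ht.1)
  let τ : ℝ → X := fun u => if u = a then η s₁ else if u = b then η s₂ else σ u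
  have hτ : IsQuasiGeodesicOn l (e + 2 * D) τ (Icc a b) := by
    refine hσ.perturb fun u _ => ?_
    simp only [τ]
    split_ifs with h h'
    · rwa [h, dist_comm]
    · rwa [h', dist_comm]
    · simpa using hD
  obtain ⟨v, hv, hd⟩ := hη.morse s₁ hs₁ s₂ hs₂ l (e + 2 * D) τ a b hl (by linarith) hab hτ
    (by simp [τ]) (by simp [τ, hba]) t ht
  refine ⟨v, hv, ?_⟩
  simp only [τ, hta, htb, if_false] at hd
  linarith

/-- The slack of `1` replaces attainment of the infimum, which may fail along a discontinuous
quasi-geodesic. -/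
theorem exists_almost_nearest (f : ℝ → X) {I : Set ℝ} (hI : I.Nonempty) (w : X) :
    ∃ m ∈ I, ∀ t ∈ I, dist w (f m) ≤ dist w (f t) + 1 := by
  have hbdd : BddBelow ((fun t => dist w (f t)) '' I) := ⟨0, by rintro _ ⟨t, _, rfl⟩; exact dist_nonneg⟩
  obtain ⟨_, ⟨m, hm, rfl⟩, hlt⟩ := exists_lt_of_csInf_lt (hI.image (fun t => dist w (f t)))
    (lt_add_one (sInf ((fun t => dist w (f t)) '' I)))
  exact ⟨m, hm, fun t ht => by linarith [csInf_le hbdd (mem_image_of_mem (fun t => dist w (f t)) ht)]⟩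

/-- A quasi-geodesic followed by a geodesic from an almost nearest point to `w` is a
quasi-geodesic. -/
theorem exists_spike (hX : IsGeodesicSpace X) {l e a b : ℝ} {σ : ℝ → X} {w : X} (hl : 1 ≤ l)
    (he : 0 ≤ e) (hab : a ≤ b) (hσ : IsQuasiGeodesicOn l e σ (Icc a b))
    (hw : ∀ s ∈ Icc a b, dist w (σ b) ≤ dist w (σ s) + 1) :
    ∃ (τ : ℝ → X) (c : ℝ), b ≤ c ∧ IsQuasiGeodesicOn (2 * l + 1) (e + 1) τ (Icc a c) ∧
      (∀ t ∈ Icc a b, τ t = σ t) ∧ τ c = w ∧ ∀ t ∈ Icc b c, dist (τ t) (σ b) ≤ dist w (σ b) := by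
  obtain ⟨_, g, hg, hg0, hg1, -⟩ := hX (σ b) w
  set L := dist (σ b) w with hL
  have hL0 : 0 ≤ L := dist_nonneg
  let τ : ℝ → X := fun t => if t ≤ b then σ t else g (t - b)
  have hτl : ∀ t, t ≤ b → τ t = σ t := fun t ht => by simp [τ, ht]
  have hτr : ∀ t, b ≤ t → τ t = g (t - b) := by
    intro t ht
    rcases ht.eq_or_lt with rfl | h
    · simp [τ, hg0]
    · simp [τ, not_le.2 h]
  have hl0 : 0 < l := by linarith
  have key : ∀ s ∈ Icc a b, ∀ t ∈ Icc b (b + L),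
      (2 * l + 1)⁻¹ * |s - t| - (e + 1) ≤ dist (τ s) (τ t) ∧
      dist (τ s) (τ t) ≤ (2 * l + 1) * |s - t| + (e + 1) := by
    intro s hs t ht
    rw [hτl s hs.2, hτr t ht.1]
    have h0 := hg 0 ⟨le_rfl, hL0⟩ (t - b) ⟨by linarith [ht.1], by linarith [ht.2]⟩
    have h1 := hg L ⟨hL0, le_rfl⟩ (t - b) ⟨by linarith [ht.1], by linarith [ht.2]⟩
    rw [hg0, abs_of_nonpos (by linarith [ht.1])] at h0
    rw [hg1, abs_of_nonneg (by linarith [ht.2])] at h1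
    have hst : |s - t| = t - s := by
      rw [abs_of_nonpos (by linarith [hs.2, ht.1])]; ring
    obtain ⟨h2, h3⟩ := hσ s hs b ⟨hab, le_rfl⟩
    rw [show |s - b| = b - s by rw [abs_of_nonpos (by linarith [hs.2])]; ring] at h2 h3
    have h4 := hw s hs
    rw [dist_comm w (σ b), ← hL] at h4
    set d := dist (σ s) (g (t - b)) with hd
    have h5 := dist_triangle w (g (t - b)) (σ s)
    rw [dist_comm (g (t - b)) (σ s)] at h5
    have h6 := dist_triangle_right (σ s) (σ b) (g (t - b))
    have h7 := dist_triangle (σ s) (σ b) (g (t - b))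
    rw [hst]
    -- As `σ b` is almost nearest to `w`, the spike point is within `d + 1` of `σ b`, so `σ s` is
    -- within `2 * d + 1` of `σ b`. Adding the length at most `d + 1` along the spike gives the
    -- constants `2 * l + 1` and `e + 1`.
    have h8 : b - s ≤ l * (2 * d + 1 + e) := by
      have : l⁻¹ * (b - s) ≤ 2 * d + 1 + e := by linarith
      rwa [inv_mul_le_iff₀ hl0] at this
    have hd0 : 0 ≤ d := dist_nonneg
    constructor
    · rw [sub_le_iff_le_add, inv_mul_le_iff₀ (by linarith)]
      nlinarith
    · nlinarith [hs.2, ht.1]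
  refine ⟨τ, b + L, by linarith, ?_, fun t ht => hτl t ht.2, ?_, ?_⟩
  · intro s hs t ht
    rcases le_total s b with hsb | hsb <;> rcases le_total t b with htb | htb
    · rw [hτl s hsb, hτl t htb]
      obtain ⟨h1, h2⟩ := hσ s ⟨hs.1, hsb⟩ t ⟨ht.1, htb⟩
      have h3 : (2 * l + 1)⁻¹ * |s - t| ≤ l⁻¹ * |s - t| := by
        gcongr; linarith
      have h4 : l * |s - t| ≤ (2 * l + 1) * |s - t| := by
        gcongr; linarith
      constructor <;> linarith
    · exact key s ⟨hs.1, hsb⟩ t ⟨htb, ht.2⟩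
    · have := key t ⟨ht.1, htb⟩ s ⟨hsb, hs.2⟩
      rwa [dist_comm, abs_sub_comm] at this
    · rw [hτr s hsb, hτr t htb, hg (s - b) ⟨by linarith, by linarith [hs.2]⟩ (t - b)
        ⟨by linarith, by linarith [ht.2]⟩, show s - b - (t - b) = s - t by ring]
      have h3 : (2 * l + 1)⁻¹ * |s - t| ≤ 1 * |s - t| := by
        gcongr; exact inv_le_one_of_one_le₀ (by linarith)
      have h4 : 1 * |s - t| ≤ (2 * l + 1) * |s - t| := by
        gcongr; linarith
      constructor <;> linarith
  · rw [hτr _ (by linarith), add_sub_cancel_left, hg1]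
  · intro t ht
    rw [hτr t ht.1, ← hg0, hg _ ⟨by linarith [ht.1], by linarith [ht.2]⟩ 0 ⟨le_rfl, hL0⟩, hg0,
      sub_zero, abs_of_nonneg (by linarith [ht.1]), dist_comm w, ← hL]
    linarith [ht.2]

theorem IsMorseGeod.spike_near_right (hX : IsGeodesicSpace X) {N : MorseGauge} {η : ℝ → X}
    {I : Set ℝ} (hη : IsMorseGeod N η I) {l e D a b s₁ s₂ : ℝ} {σ : ℝ → X} {w : X} (hl : 1 ≤ l)
    (he : 0 ≤ e) (hs₁ : s₁ ∈ I) (hs₂ : s₂ ∈ I) (hab : a ≤ b)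
    (hσ : IsQuasiGeodesicOn l e σ (Icc a b))
    (hw : ∀ s ∈ Icc a b, dist w (σ b) ≤ dist w (σ s) + 1)
    (h₁ : dist (σ a) (η s₁) ≤ D) (h₂ : dist w (η s₂) ≤ D) :
    ∀ t ∈ Icc a b, ∃ s ∈ uIcc s₁ s₂,
      dist (σ t) (η s) ≤ gaugeVal N (2 * l + 1) (e + 1 + 2 * D) + D := by
  obtain ⟨τ, c, hbc, hτ, hτσ, hτc, -⟩ := exists_spike hX hl he hab hσ hw
  intro t ht
  rw [← hτσ t ht]
  refine hη.near (by linarith) (by linarith) hs₁ hs₂ (hab.trans hbc) hτ ?_ ?_ t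
    ⟨ht.1, ht.2.trans hbc⟩
  · rwa [hτσ a ⟨le_rfl, hab⟩]
  · rwa [hτc]

theorem IsMorseGeod.spike_near_left (hX : IsGeodesicSpace X) {N : MorseGauge} {η : ℝ → X}
    {I : Set ℝ} (hη : IsMorseGeod N η I) {l e D a b s₁ s₂ : ℝ} {σ : ℝ → X} {w : X} (hl : 1 ≤ l)
    (he : 0 ≤ e) (hs₁ : s₁ ∈ I) (hs₂ : s₂ ∈ I) (hab : a ≤ b)
    (hσ : IsQuasiGeodesicOn l e σ (Icc a b))
    (hw : ∀ s ∈ Icc a b, dist w (σ a) ≤ dist w (σ s) + 1)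
    (h₁ : dist w (η s₁) ≤ D) (h₂ : dist (σ b) (η s₂) ≤ D) :
    ∀ t ∈ Icc a b, ∃ s ∈ uIcc s₁ s₂,
      dist (σ t) (η s) ≤ gaugeVal N (2 * l + 1) (e + 1 + 2 * D) + D := by
  intro t ht
  have := hη.spike_near_right hX hl he hs₂ hs₁ (neg_le_neg hab) hσ.reverse (w := w) (D := D)
    (fun s hs => by
      simpa using hw (-s) ⟨by linarith [hs.2], by linarith [hs.1]⟩)
    (by simpa using h₂) h₁ (-t) ⟨by linarith [ht.2], by linarith [ht.1]⟩
  simpa [uIcc_comm] using this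

/-- A geodesic whose endpoints are close to a Morse geodesic is, away from its endpoints, uniformly
close to it. -/
theorem IsMorseGeod.near_of_ends_near (hX : IsGeodesicSpace X) {N : MorseGauge} {η : ℝ → X}
    {I : Set ℝ} (hη : IsMorseGeod N η I) {C u v s₁ s₂ : ℝ} {α : ℝ → X}
    (hα : IsGeodesicOn α (Icc u v)) (hs₁ : s₁ ∈ I) (hs₂ : s₂ ∈ I)
    (h₁ : dist (α u) (η s₁) ≤ C) (h₂ : dist (α v) (η s₂) ≤ C) :
    ∀ t ∈ Icc (u + (4 * C + 5)) (v - (4 * C + 5)), ∃ s ∈ uIcc s₁ s₂,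
      dist (α t) (η s) ≤ gaugeVal N 7 2 := by
  intro t ht
  have hC : 0 ≤ C := dist_nonneg.trans h₁
  have huv : u ≤ v := by linarith [ht.1, ht.2]
  obtain ⟨t₁, ht₁, hn₁⟩ := exists_almost_nearest α (nonempty_Icc.2 huv) (η s₁)
  have hd₁ := hn₁ u ⟨le_rfl, huv⟩
  have hg₁ := hα u ⟨le_rfl, huv⟩ t₁ ht₁
  rw [abs_of_nonpos (by linarith [ht₁.1])] at hg₁
  have htr₁ := dist_triangle (α u) (η s₁) (α t₁)
  rw [dist_comm (η s₁) (α u)] at hd₁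
  have ht₁t : t₁ ≤ t := by linarith [ht.1]
  have ht₁v : t₁ ≤ v := ht₁.2
  -- The second foot is sought only beyond the first, so that `α` is kept on `[t₁, t₂]` and gets a
  -- spike at each end. The constants grow from `(1, 0)` to `(3, 1)` to `(7, 2)`, independently of
  -- `C`.
  obtain ⟨t₂, ht₂, hn₂⟩ := exists_almost_nearest α (nonempty_Icc.2 ht₁v) (η s₂)
  have hd₂ := hn₂ v ⟨ht₁v, le_rfl⟩
  have hg₂ := hα t₂ ⟨ht₁.1.trans ht₂.1, ht₂.2⟩ v ⟨huv, le_rfl⟩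
  rw [abs_of_nonpos (by linarith [ht₂.2])] at hg₂
  have htr₂ := dist_triangle_right (α t₂) (α v) (η s₂)
  rw [dist_comm (η s₂) (α v)] at hd₂
  rw [dist_comm (η s₂) (α t₂)] at hd₂
  have htt₂ : t ≤ t₂ := by linarith [ht.2]
  have hα' : IsGeodesicOn α (Icc t₁ t₂) := hα.mono (Icc_subset_Icc ht₁.1 ht₂.2)
  obtain ⟨τ, c, hc, hτ, hτα, hτc, hτd⟩ := exists_spike hX le_rfl le_rfl ht₂.1
    hα'.isQuasiGeodesicOn (w := η s₂) (fun s hs => hn₂ s ⟨hs.1, hs.2.trans ht₂.2⟩)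
  have h12 := hα' t₁ ⟨le_rfl, ht₂.1⟩ t₂ ⟨ht₂.1, le_rfl⟩
  rw [abs_of_nonpos (by linarith [ht₂.1])] at h12
  have := hη.spike_near_left hX (by norm_num) (by norm_num) hs₁ hs₂ (ht₂.1.trans hc) hτ
    (w := η s₁) (D := 0) (fun s hs => by
      rw [hτα t₁ ⟨le_rfl, ht₂.1⟩]
      rcases le_total s t₂ with h | h
      · rw [hτα s ⟨hs.1, h⟩]
        exact hn₁ s ⟨ht₁.1.trans hs.1, h.trans ht₂.2⟩
      · have h3 := hτd s ⟨h, hs.2⟩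
        have h4 := dist_triangle4 (α t₁) (η s₁) (τ s) (α t₂)
        rw [dist_comm (α t₁) (η s₁)] at h4
        rw [dist_comm (η s₂) (α t₂)] at h3
        linarith [ht.1, ht.2])
    (by simp) (by simp [hτc]) t ⟨ht₁t, htt₂.trans hc⟩
  rw [hτα t ⟨ht₁t, htt₂⟩] at this
  norm_num at this
  exact this

/-- The constant to which a geodesic with a given foot of `w` is close to a Morse geodesic passing
within `D` of `w`. -/
noncomputable def footConst (N : MorseGauge) (D : ℝ) : ℝ :=
  gaugeVal N 3 (1 + 2 * (D + gaugeVal N 7 2)) + (D + gaugeVal N 7 2)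

theorem footConst_nonneg (N : MorseGauge) {D : ℝ} (hD : 0 ≤ D) : 0 ≤ footConst N D := by
  have := gaugeVal_nonneg N 3 (1 + 2 * (D + gaugeVal N 7 2))
  have := gaugeVal_nonneg N 7 2
  unfold footConst; linarith

/-- The unknown bound `C` is removed at both ends: far out, `near_of_ends_near` replaces it by
`gaugeVal N 7 2`, and at the start the spike from `w` replaces it by `D`. -/
theorem IsMorseGeod.ray_near_of_foot (hX : IsGeodesicSpace X) {N : MorseGauge} {η : ℝ → X}
    {I : Set ℝ} (hη : IsMorseGeod N η I) {C D s₁ : ℝ} {r : ℝ → X} {w : X}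
    (hr : IsGeodesicOn r (Ici 0)) (hC : ∀ t, 0 ≤ t → ∃ s ∈ I, dist (r t) (η s) ≤ C)
    (hw : ∀ t, 0 ≤ t → dist w (r 0) ≤ dist w (r t) + 1) (hs₁ : s₁ ∈ I) (hwη : dist w (η s₁) ≤ D) :
    ∀ t, 0 ≤ t → ∃ s ∈ I, dist (r t) (η s) ≤ footConst N D := by
  intro t ht
  obtain ⟨s₀, hs₀, h₀⟩ := hC 0 le_rfl
  have hC0 : 0 ≤ C := dist_nonneg.trans h₀
  have hD0 : 0 ≤ D := dist_nonneg.trans hwη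
  have hN := gaugeVal_nonneg N 7 2
  obtain ⟨s₂, hs₂, h₂⟩ := hC (t + 2 * (4 * C + 5)) (by linarith)
  obtain ⟨s₃, hs₃, h₃⟩ := hη.near_of_ends_near hX (hr.mono Icc_subset_Ici_self) hs₀ hs₂ h₀ h₂
    (t + (4 * C + 5)) ⟨by linarith, by linarith⟩
  have hs₃' := hη.ordConnected.uIcc_subset hs₀ hs₂ hs₃
  have hT : 0 ≤ t + (4 * C + 5) := by linarith
  obtain ⟨s, hs, h⟩ := hη.spike_near_left hX le_rfl le_rfl hs₁ hs₃' hT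
    (hr.mono Icc_subset_Ici_self).isQuasiGeodesicOn (w := w) (D := D + gaugeVal N 7 2)
    (fun s hs => hw s hs.1) (by linarith) (by linarith) t ⟨ht, by linarith⟩
  refine ⟨s, hη.ordConnected.uIcc_subset hs₁ hs₃' hs, ?_⟩
  norm_num at h
  exact h

/-- A line whose two halves are near Morse geodesics `η₁`, `η₂` is uniformly near them, if these
pass near a common point. -/
theorem exists_foot (hX : IsGeodesicSpace X) {N : MorseGauge} {η₁ η₂ : ℝ → X}
    {I₁ I₂ : Set ℝ} (hη₁ : IsMorseGeod N η₁ I₁) (hη₂ : IsMorseGeod N η₂ I₂)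
    {C₁ C₂ D s₁ s₂ : ℝ} {α : ℝ → X} {w : X} (hα : IsGeodesicOn α univ)
    (h₁ : ∀ t, 0 ≤ t → ∃ s ∈ I₁, dist (α (-t)) (η₁ s) ≤ C₁)
    (h₂ : ∀ t, 0 ≤ t → ∃ s ∈ I₂, dist (α t) (η₂ s) ≤ C₂)
    (hs₁ : s₁ ∈ I₁) (hs₂ : s₂ ∈ I₂) (hw₁ : dist w (η₁ s₁) ≤ D) (hw₂ : dist w (η₂ s₂) ≤ D) :
    ∃ m, (∀ t ≤ m, ∃ s ∈ I₁, dist (α t) (η₁ s) ≤ footConst N D) ∧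
      ∀ t ≥ m, ∃ s ∈ I₂, dist (α t) (η₂ s) ≤ footConst N D := by
  -- The line is cut at the foot of `w`, so both halves are rays with that foot; shifting the origin
  -- to `m` costs `|m|` in the non-uniform bounds only.
  obtain ⟨m, -, hm⟩ := exists_almost_nearest α univ_nonempty w
  have hdist : ∀ s t, dist (α s) (α t) = |s - t| := fun s t => hα s trivial t trivial
  refine ⟨m, fun t ht => ?_, fun t ht => ?_⟩
  · obtain ⟨s, hs, h⟩ := hη₁.ray_near_of_foot hX (r := fun t => α (m - t)) (C := C₁ + |m|) (w := w)
      (hα.comp (fun _ _ => trivial) fun s t => by rw [← abs_neg]; congr 1; ring)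
      (fun t ht => by
        rcases le_total 0 (t - m) with h | h
        · obtain ⟨s, hs, hd⟩ := h₁ (t - m) h
          exact ⟨s, hs, by rw [neg_sub] at hd; linarith [abs_nonneg m]⟩
        · obtain ⟨s, hs, hd⟩ := h₁ 0 le_rfl
          refine ⟨s, hs, (dist_triangle _ (α (-0)) _).trans ?_⟩
          have : dist (α (m - t)) (α (-0)) ≤ |m| := by
            rw [hdist, neg_zero, sub_zero, abs_of_nonneg (by linarith)]
            exact le_trans (by linarith) (le_abs_self m)
          linarith)
      (fun t _ => by simpa using hm (m - t) trivial) hs₁ hw₁ (m - t) (by linarith)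
    exact ⟨s, hs, by simpa using h⟩
  · obtain ⟨s, hs, h⟩ := hη₂.ray_near_of_foot hX (r := fun t => α (m + t)) (C := C₂ + |m|) (w := w)
      (hα.comp (fun _ _ => trivial) fun s t => by congr 1; ring)
      (fun t ht => by
        rcases le_total 0 (m + t) with h | h
        · obtain ⟨s, hs, hd⟩ := h₂ (m + t) h
          exact ⟨s, hs, by linarith [abs_nonneg m]⟩
        · obtain ⟨s, hs, hd⟩ := h₂ 0 le_rfl
          refine ⟨s, hs, (dist_triangle _ (α 0) _).trans ?_⟩
          have : dist (α (m + t)) (α 0) ≤ |m| := by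
            rw [hdist, sub_zero, abs_of_nonpos h]
            exact le_trans (by linarith) (neg_le_abs m)
          linarith)
      (fun t _ => by simpa using hm (m + t) trivial) hs₂ hw₂ (t - m) (by linarith)
    exact ⟨s, hs, by simpa using h⟩

/-- Gauge of geodesics in the `E`-neighbourhood of an `N`-Morse geodesic. -/
noncomputable def closeGauge (N : MorseGauge) (E : ℝ) : MorseGauge :=
  gaugeOf fun l e => gaugeVal N l (e + 2 * E) + 2 * gaugeVal N 1 (0 + 2 * E) + 6 * E

theorem IsMorseGeod.of_near {N : MorseGauge} {η r : ℝ → X} {I J : Set ℝ}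
    (hη : IsMorseGeod N η I) {E : ℝ} (hr : IsGeodesicOn r J) (hJ : J.OrdConnected)
    (hE : ∀ t ∈ J, ∃ s ∈ I, dist (r t) (η s) ≤ E) : IsMorseGeod (closeGauge N E) r J := by
  have main : ∀ s ∈ J, ∀ t ∈ J, s ≤ t → ∀ (l e : ℝ) (σ : ℝ → X) (a b : ℝ), 1 ≤ l → 0 ≤ e → a ≤ b →
      IsQuasiGeodesicOn l e σ (Icc a b) → σ a = r s → σ b = r t →
      ∀ u ∈ Icc a b, ∃ v ∈ Icc s t, dist (σ u) (r v) ≤ gaugeVal (closeGauge N E) l e := by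
    intro s hs t ht hst l e σ a b hl he hab hσ ha hb u hu
    obtain ⟨s', hs', hds⟩ := hE s hs
    obtain ⟨t', ht', hdt⟩ := hE t ht
    have hE0 : 0 ≤ E := dist_nonneg.trans hds
    obtain ⟨v, hv, hdv⟩ := hη.near hl he hs' ht' hab hσ (ha ▸ hds) (hb ▸ hdt) u hu
    have hvI := hη.ordConnected.uIcc_subset hs' ht' hv
    have hr' : IsGeodesicOn r (Icc s t) := hr.mono (hJ.out hs ht)
    have h1 := hη.geodesic s' hs' t' ht'
    have h2 := hr' s ⟨le_rfl, hst⟩ t ⟨hst, le_rfl⟩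
    rw [abs_of_nonpos (by linarith)] at h2
    have h3 := dist_triangle4 (η s') (r s) (r t) (η t')
    rw [dist_comm (η s') (r s)] at h3
    -- The point of `r` is chosen at the same distance from `r s` as `η v` from `η s'`, cut off at
    -- the length of the segment; the cut-off loses at most `2 * E`.
    have hτ : ∃ τ ∈ Icc 0 (t - s), |v - s'| - 2 * E ≤ τ ∧ τ ≤ |v - s'| := by
      have h4 : |v - s'| ≤ |t' - s'| := by
        rw [mem_uIcc] at hv
        rcases hv with hv | hv
        · rw [abs_of_nonneg (by linarith), abs_of_nonneg (by linarith)]; linarith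
        · rw [abs_of_nonpos (by linarith), abs_of_nonpos (by linarith)]; linarith
      rw [abs_sub_comm s' t'] at h1
      refine ⟨min |v - s'| (t - s), ⟨le_min (abs_nonneg _) (by linarith), min_le_right _ _⟩, ?_,
        min_le_left _ _⟩
      exact le_min (by linarith) (by linarith)
    obtain ⟨τ, hτ, hτ1, hτ2⟩ := hτ
    obtain ⟨v', hv', hdv'⟩ := hη.near le_rfl le_rfl hs' ht' hst hr'.isQuasiGeodesicOn hds hdt
      (s + τ) ⟨by linarith [hτ.1], by linarith [hτ.2]⟩
    have hvI' := hη.ordConnected.uIcc_subset hs' ht' hv'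
    have h5 := hr' s ⟨le_rfl, hst⟩ (s + τ) ⟨by linarith [hτ.1], by linarith [hτ.2]⟩
    rw [show s - (s + τ) = -τ by ring, abs_neg, abs_of_nonneg hτ.1] at h5
    have h6 := hη.geodesic s' hs' v' hvI'
    have h7 := hη.geodesic v hvI v' hvI'
    -- Both `v` and `v'` lie on the same side of `s'`, so their distance is the difference of their
    -- distances to `s'`.
    have h8 : |v - v'| = |(|v - s'| - |s' - v'|)| := by
      rw [mem_uIcc] at hv hv'
      rcases hv with hv | hv <;> rcases hv' with hv' | hv'
      · rw [abs_of_nonneg (by linarith : 0 ≤ v - s'), abs_of_nonpos (by linarith : s' - v' ≤ 0)]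
        congr 1; ring
      · have : v = s' := by linarith
        have : v' = s' := by linarith
        simp_all
      · have : v = s' := by linarith
        have : v' = s' := by linarith
        simp_all
      · rw [abs_of_nonpos (by linarith : v - s' ≤ 0), abs_of_nonneg (by linarith : 0 ≤ s' - v')]
        rw [← abs_neg]; congr 1; ring
    have h9 := dist_triangle4 (η s') (r s) (r (s + τ)) (η v')
    rw [dist_comm (η s') (r s)] at h9
    have h10 := dist_triangle4 (r s) (η s') (η v') (r (s + τ))
    rw [dist_comm (η v')] at h10
    have h11 : dist (η v) (η v') ≤ gaugeVal N 1 (0 + 2 * E) + 4 * E := by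
      rw [h7, h8, abs_le]
      constructor <;> linarith
    refine ⟨s + τ, ⟨by linarith [hτ.1], by linarith [hτ.2]⟩, ?_⟩
    have h12 := dist_triangle4 (σ u) (η v) (η v') (r (s + τ))
    rw [dist_comm (η v')] at h12
    refine le_trans ?_ (le_gaugeVal_gaugeOf _ hl he)
    linarith
  refine ⟨hr, hJ, ?_⟩
  intro s hs t ht l e σ a b hl he hab hσ ha hb u hu
  rcases le_total s t with hst | hst
  · rw [uIcc_of_le hst]
    exact main s hs t ht hst l e σ a b hl he hab hσ ha hb u hu
  · rw [uIcc_of_ge hst]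
    obtain ⟨v, hv, hd⟩ := main t ht s hs hst l e _ (-b) (-a) hl he (by linarith) hσ.reverse
      (by simpa using hb) (by simpa using ha) (-u) ⟨by linarith [hu.2], by linarith [hu.1]⟩
    exact ⟨v, hv, by simpa using hd⟩

/-- Gauge of the concatenation of two `N`-Morse geodesics. -/
noncomputable def concatGauge (N : MorseGauge) : MorseGauge :=
  gaugeOf fun l e => max (gaugeVal N l e) (gaugeVal N (2 * l + 1) (e + 1))

/-- A quasi-geodesic joining the two halves is cut at an almost nearest point to `γ m`; with a spike
to `γ m`, each piece has both endpoints on a single half. -/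
theorem IsMorseGeod.concat (hX : IsGeodesicSpace X) {N : MorseGauge} {γ : ℝ → X} {m : ℝ}
    (hγ : IsGeodesicOn γ univ) (h₁ : IsMorseGeod N γ (Iic m)) (h₂ : IsMorseGeod N γ (Ici m)) :
    IsMorseGeod (concatGauge N) γ univ := by
  have mixed : ∀ (I J : Set ℝ), IsMorseGeod N γ I → IsMorseGeod N γ J → m ∈ I → m ∈ J →
      ∀ s ∈ I, ∀ t ∈ J, m ∈ uIcc s t → ∀ (l e : ℝ) (σ : ℝ → X) (a b : ℝ), 1 ≤ l → 0 ≤ e → a ≤ b →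
      IsQuasiGeodesicOn l e σ (Icc a b) → σ a = γ s → σ b = γ t →
      ∀ u ∈ Icc a b, ∃ v ∈ uIcc s t, dist (σ u) (γ v) ≤ gaugeVal N (2 * l + 1) (e + 1) := by
    intro I J hI hJ hmI hmJ s hs t ht hm l e σ a b hl he hab hσ ha hb u hu
    obtain ⟨c, hc, hn⟩ := exists_almost_nearest σ (nonempty_Icc.2 hab) (γ m)
    rcases le_total u c with h | h
    · obtain ⟨v, hv, hd⟩ := hI.spike_near_right hX hl he hs hmI hc.1
        (hσ.mono (Icc_subset_Icc_right hc.2)) (w := γ m) (D := 0)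
        (fun s hs => hn s ⟨hs.1, hs.2.trans hc.2⟩) (by simp [ha]) (by simp) u ⟨hu.1, h⟩
      exact ⟨v, uIcc_subset_uIcc left_mem_uIcc hm hv, by simpa using hd⟩
    · obtain ⟨v, hv, hd⟩ := hJ.spike_near_left hX hl he hmJ ht hc.2
        (hσ.mono (Icc_subset_Icc_left hc.1)) (w := γ m) (D := 0)
        (fun s hs => hn s ⟨hc.1.trans hs.1, hs.2⟩) (by simp) (by simp [hb]) u ⟨h, hu.2⟩
      exact ⟨v, uIcc_subset_uIcc hm right_mem_uIcc hv, by simpa using hd⟩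
  refine ⟨hγ, ordConnected_univ, ?_⟩
  intro s _ t _ l e σ a b hl he hab hσ ha hb u hu
  have hmax := le_gaugeVal_gaugeOf
    (fun l e => max (gaugeVal N l e) (gaugeVal N (2 * l + 1) (e + 1))) hl he
  have hle₁ := (le_max_left _ _).trans hmax
  have hle₂ := (le_max_right _ _).trans hmax
  rcases le_total s m with hs | hs <;> rcases le_total t m with ht | ht
  · obtain ⟨v, hv, hd⟩ := h₁.morse s hs t ht l e σ a b hl he hab hσ ha hb u hu
    exact ⟨v, hv, hd.trans hle₁⟩
  · obtain ⟨v, hv, hd⟩ := mixed _ _ h₁ h₂ self_mem_Iic self_mem_Ici s hs t ht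
      (mem_uIcc.2 (Or.inl ⟨hs, ht⟩)) l e σ a b hl he hab hσ ha hb u hu
    exact ⟨v, hv, hd.trans hle₂⟩
  · obtain ⟨v, hv, hd⟩ := mixed _ _ h₂ h₁ self_mem_Ici self_mem_Iic s hs t ht
      (mem_uIcc.2 (Or.inr ⟨ht, hs⟩)) l e σ a b hl he hab hσ ha hb u hu
    exact ⟨v, hv, hd.trans hle₂⟩
  · obtain ⟨v, hv, hd⟩ := h₂.morse s hs t ht l e σ a b hl he hab hσ ha hb u hu
    exact ⟨v, hv, hd.trans hle₁⟩

end MorseGeometry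

/-! ### Ideal triangles, and lines between boundary points. -/

section IdealGeometry

variable {X : Type u} [MetricSpace X]

/-- Two parametrized rays stay at bounded distance. -/
def Par (r r' : ℝ → X) : Prop := ∃ C, ∀ t, 0 ≤ t → dist (r t) (r' t) ≤ C

theorem Par.symm {r r' : ℝ → X} (h : Par r r') : Par r' r := by
  obtain ⟨C, hC⟩ := h
  exact ⟨C, fun t ht => dist_comm (r t) (r' t) ▸ hC t ht⟩

theorem Par.trans {r r' r'' : ℝ → X} (h : Par r r') (h' : Par r' r'') : Par r r'' := by
  obtain ⟨C, hC⟩ := h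
  obtain ⟨C', hC'⟩ := h'
  exact ⟨C + C', fun t ht => (dist_triangle _ _ _).trans (add_le_add (hC t ht) (hC' t ht))⟩

/-- Both parameters measure distance from the origin of a ray, so they agree up to `C` plus the
distance between the origins. -/
theorem par_of_near {r r' : ℝ → X} (hr : IsGeodesicOn r (Ici 0)) (hr' : IsGeodesicOn r' (Ici 0))
    {C : ℝ} (h : ∀ t, 0 ≤ t → ∃ s, 0 ≤ s ∧ dist (r t) (r' s) ≤ C) : Par r r' := by
  refine ⟨2 * C + dist (r 0) (r' 0), fun t ht => ?_⟩
  obtain ⟨s, hs, hd⟩ := h t ht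
  have h1 := hr 0 self_mem_Ici t ht
  have h2 := hr' 0 self_mem_Ici s hs
  have h3 := hr' s hs t ht
  rw [zero_sub, abs_neg, abs_of_nonneg ht] at h1
  rw [zero_sub, abs_neg, abs_of_nonneg hs] at h2
  have h4 := dist_triangle4 (r 0) (r' 0) (r' s) (r t)
  have h5 := dist_triangle4 (r' 0) (r 0) (r t) (r' s)
  have h6 := dist_triangle (r t) (r' s) (r' t)
  rw [dist_comm (r' s)] at h4
  rw [dist_comm (r' 0) (r 0)] at h5
  have h7 : |s - t| ≤ C + dist (r 0) (r' 0) := by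
    rw [abs_le]; constructor <;> linarith
  linarith

theorem asymptotic_iff_par {r r' : ℝ → X} (hr : IsGeodesicOn r (Ici 0))
    (hr' : IsGeodesicOn r' (Ici 0)) : Asymptotic (r '' Ici 0) (r' '' Ici 0) ↔ Par r r' := by
  constructor
  · intro h
    refine par_of_near hr hr' (C := Metric.hausdorffDist (r '' Ici 0) (r' '' Ici 0) + 1)
      fun t ht => ?_
    obtain ⟨_, ⟨s, hs, rfl⟩, hd⟩ := Metric.exists_dist_lt_of_hausdorffDist_lt
      (mem_image_of_mem r (mem_Ici.2 ht)) (lt_add_one _) h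
    exact ⟨s, hs, hd.le⟩
  · rintro ⟨C, hC⟩
    refine ne_top_of_le_ne_top (b := ENNReal.ofReal C) ENNReal.ofReal_ne_top
      (Metric.hausdorffEDist_le_of_mem_edist ?_ ?_)
    · rintro _ ⟨t, ht, rfl⟩
      exact ⟨_, mem_image_of_mem r' ht, by
        rw [edist_dist]; exact ENNReal.ofReal_le_ofReal (hC t ht)⟩
    · rintro _ ⟨t, ht, rfl⟩
      exact ⟨_, mem_image_of_mem r ht, by
        rw [edist_dist, dist_comm]; exact ENNReal.ofReal_le_ofReal (hC t ht)⟩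

/-- The ray `r` represents the boundary point `a`. -/
def EndsAt {p : X} (r : ℝ → X) (a : MorseBoundary p) : Prop :=
  ∃ α : GeodesicRay p, α.endpoint = a.1 ∧ Par r α.toFun

theorem GeodesicRay.endpoint_eq_iff {p : X} {α β : GeodesicRay p} :
    α.endpoint = β.endpoint ↔ Par α.toFun β.toFun :=
  Quotient.eq.trans (asymptotic_iff_par α.geodesic β.geodesic)

theorem EndsAt.par {p : X} {r r' : ℝ → X} {a : MorseBoundary p} (h : EndsAt r a)
    (h' : EndsAt r' a) : Par r r' := by
  obtain ⟨α, hα, hr⟩ := h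
  obtain ⟨β, hβ, hr'⟩ := h'
  exact (hr.trans (GeodesicRay.endpoint_eq_iff.1 (hα.trans hβ.symm))).trans hr'.symm

theorem isLineFromTo_iff {p : X} {γ : ℝ → X} {a b : MorseBoundary p} :
    IsLineFromTo γ a b ↔
      IsGeodesicOn γ univ ∧ EndsAt (fun t => γ (-t)) a ∧ EndsAt γ b := by
  refine and_congr_right fun hγ => ?_
  have hneg : IsGeodesicOn (fun t => γ (-t)) (Ici 0) :=
    hγ.comp (fun _ _ => trivial) fun s t => by rw [← abs_neg]; congr 1; ring
  have himg : γ '' Iic 0 = (fun t => γ (-t)) '' Ici 0 := by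
    ext x
    constructor
    · rintro ⟨t, ht, rfl⟩
      exact ⟨-t, by simpa using ht, by simp⟩
    · rintro ⟨t, ht, rfl⟩
      exact ⟨-t, by simpa using ht, rfl⟩
  rw [himg]
  refine and_congr (exists_congr fun α => and_congr_right fun _ => ?_)
    (exists_congr fun α => and_congr_right fun _ => ?_)
  · exact asymptotic_iff_par hneg α.geodesic
  · exact asymptotic_iff_par (hγ.mono (subset_univ _)) α.geodesic

theorem IsLineFromTo.endsAt_left {p : X} {γ : ℝ → X} {a b : MorseBoundary p}
    (h : IsLineFromTo γ a b) : EndsAt (fun t => γ (-t)) a := (isLineFromTo_iff.1 h).2.1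

theorem IsLineFromTo.endsAt_right {p : X} {γ : ℝ → X} {a b : MorseBoundary p}
    (h : IsLineFromTo γ a b) : EndsAt γ b := (isLineFromTo_iff.1 h).2.2

theorem IsLineFromTo.reverse {p : X} {γ : ℝ → X} {a b : MorseBoundary p}
    (h : IsLineFromTo γ a b) : IsLineFromTo (fun t => γ (-t)) b a := by
  obtain ⟨h1, h2, h3⟩ := isLineFromTo_iff.1 h
  exact isLineFromTo_iff.2 ⟨h1.comp (fun _ _ => trivial) fun s t => by
    rw [← abs_neg]; congr 1; ring, by simpa using h3, h2⟩

theorem IsMorseGeod.near_of_par (hX : IsGeodesicSpace X) {N : MorseGauge} {l l' : ℝ → X}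
    (hl : IsGeodesicOn l univ) (hl' : IsMorseGeod N l' univ)
    (h : Par l l') (hneg : Par (fun t => l (-t)) fun t => l' (-t)) (t : ℝ) :
    ∃ s, dist (l t) (l' s) ≤ gaugeVal N 7 2 := by
  obtain ⟨C, hC⟩ := h
  obtain ⟨C', hC'⟩ := hneg
  have hall : ∀ t, dist (l t) (l' t) ≤ max C C' := by
    intro t
    rcases le_total 0 t with ht | ht
    · exact (hC t ht).trans (le_max_left _ _)
    · simpa using (hC' (-t) (by linarith)).trans (le_max_right _ _)
  obtain ⟨s, -, hs⟩ := hl'.near_of_ends_near hX (hl.mono (subset_univ _))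
    (mem_univ _) (mem_univ _) (hall (t - (4 * max C C' + 5))) (hall (t + (4 * max C C' + 5))) t
    ⟨by linarith, by linarith⟩
  exact ⟨s, hs⟩

/-- Away from the origin the unknown parallelism constant is replaced by `gaugeVal N 7 2`, which
gives uniform vertices arbitrarily far out. -/
theorem Par.exists_far_near (hX : IsGeodesicSpace X) {N : MorseGauge} {r r' : ℝ → X}
    (h : Par r r') (hr : IsGeodesicOn r (Ici 0)) (hr' : IsMorseGeod N r' (Ici 0)) (R : ℝ) :
    ∃ S ≥ R, ∃ S' ≥ R, dist (r S) (r' S') ≤ gaugeVal N 7 2 := by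
  obtain ⟨C, hC⟩ := h
  have hC0 : 0 ≤ C := dist_nonneg.trans (hC 0 le_rfl)
  have hN := gaugeVal_nonneg N 7 2
  have hR := le_max_left R 0
  have hR0 := le_max_right R 0
  set S := max R 0 + C + gaugeVal N 7 2 + (4 * C + 5) with hS
  have hS0 : 0 ≤ S := by linarith
  obtain ⟨S', hS', hd⟩ := hr'.near_of_ends_near hX (u := 0) (v := S + (4 * C + 5))
    (hr.mono Icc_subset_Ici_self) (mem_Ici.2 le_rfl)
    (mem_Ici.2 (by linarith)) (hC 0 le_rfl) (hC _ (by linarith)) S ⟨by linarith, by linarith⟩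
  have hS'0 : 0 ≤ S' := hr'.ordConnected.uIcc_subset (mem_Ici.2 le_rfl)
    (mem_Ici.2 (by linarith)) hS'
  refine ⟨S, by linarith, S', ?_, hd⟩
  have h1 := hr 0 self_mem_Ici S hS0
  have h2 := hr'.geodesic 0 self_mem_Ici S' hS'0
  rw [zero_sub, abs_neg, abs_of_nonneg hS0] at h1
  rw [zero_sub, abs_neg, abs_of_nonneg hS'0] at h2
  have h3 := dist_triangle4 (r 0) (r' 0) (r' S') (r S)
  rw [dist_comm (r' S')] at h3
  have := hC 0 le_rfl
  linarith

/-- Slimness constant of ideal triangles with two `N`-Morse sides. -/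
noncomputable def slimConst (N : MorseGauge) : ℝ := footConst N (gaugeVal N 7 2)

theorem slimConst_nonneg (N : MorseGauge) : 0 ≤ slimConst N :=
  footConst_nonneg N (gaugeVal_nonneg N 7 2)

/-- A point `w` of `β` far towards `c` is also near `γ`. Cutting `α` at the foot of `w` makes one
half follow `γ` and the other follow `β`. -/
theorem IsIdealTriangle.exists_foot (hX : IsGeodesicSpace X) {p : X} {N : MorseGauge}
    {α β γ : ℝ → X} {a b c : MorseBoundary p} (h : IsIdealTriangle α β γ a b c)
    (hβ : IsMorseGeod N β univ) (hγ : IsMorseGeod N γ univ) :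
    ∃ m, (∀ t ≤ m, ∃ s, dist (α t) (γ s) ≤ slimConst N) ∧
      ∀ t ≥ m, ∃ s, dist (α t) (β s) ≤ slimConst N := by
  obtain ⟨h1, h2, h3⟩ := h
  obtain ⟨C₁, hC₁⟩ := h1.endsAt_left.par h3.endsAt_right
  obtain ⟨C₂, hC₂⟩ := h1.endsAt_right.par h2.endsAt_left
  obtain ⟨S, -, S', -, hS⟩ := (h2.endsAt_right.par h3.endsAt_left).exists_far_near hX
    (hβ.geodesic.mono (subset_univ _)) (hγ.comp_neg.mono (subset_univ _) ordConnected_Ici) 0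
  obtain ⟨m, hm₁, hm₂⟩ := MorseHHS.exists_foot hX hγ hβ (w := β S) h1.1
    (fun t ht => ⟨t, trivial, hC₁ t ht⟩) (fun t ht => ⟨-t, trivial, hC₂ t ht⟩)
    (mem_univ (-S')) (mem_univ S) hS (by simpa using gaugeVal_nonneg N 7 2)
  exact ⟨m, fun t ht => by simpa [slimConst] using hm₁ t ht, fun t ht => by simpa [slimConst] using hm₂ t ht⟩

theorem hasInternalTriples (hX : IsGeodesicSpace X) (p : X) (N : MorseGauge) :
    HasInternalTriples p N (2 * slimConst N) := by
  intro a b c α β γ h _ hβ hγ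
  obtain ⟨m, h1, h2⟩ := h.exists_foot hX (isMorseGeodesicOn_univ_iff.1 hβ)
    (isMorseGeodesicOn_univ_iff.1 hγ)
  obtain ⟨t, ht⟩ := h1 m le_rfl
  obtain ⟨s, hs⟩ := h2 m le_rfl
  have := slimConst_nonneg N
  refine ⟨m, s, t, by linarith, ?_, ?_⟩
  · have := dist_triangle_left (β s) (γ t) (α m)
    linarith
  · rw [dist_comm]; linarith

/-- Admissibility passes to larger constants, so adding `1` spares the question of whether the
infimum is attained. -/
theorem centerConst_spec (hX : IsGeodesicSpace X) (p : X) (N : MorseGauge) :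
    0 ≤ centerConst p N ∧ HasInternalTriples p N (centerConst p N) := by
  obtain ⟨K, ⟨hK0, hK⟩, hlt⟩ := exists_lt_of_csInf_lt
    (s := {K : ℝ | 0 ≤ K ∧ HasInternalTriples p N K})
    ⟨_, mul_nonneg zero_le_two (slimConst_nonneg N), hasInternalTriples hX p N⟩
    (lt_add_one _)
  change K < centerConst p N at hlt
  refine ⟨hK0.trans hlt.le, fun a b c α β γ h h1 h2 h3 => ?_⟩
  obtain ⟨r, s, t, h4, h5, h6⟩ := hK a b c α β γ h h1 h2 h3
  exact ⟨r, s, t, h4.trans hlt.le, h5.trans hlt.le, h6.trans hlt.le⟩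

/-- A point near a line nearly realizes the distance between points near the line on both sides. -/
theorem dist_add_dist_le_of_near_line {l : ℝ → X} (hl : IsGeodesicOn l univ) {P Q x : X}
    {S S' u K d : ℝ} (hP : dist P (l (-S)) ≤ d) (hQ : dist Q (l S') ≤ d) (hx : dist x (l u) ≤ K)
    (h₁ : -S ≤ u) (h₂ : u ≤ S') : dist P x + dist x Q ≤ dist P Q + (2 * K + 4 * d) := by
  have e1 := hl (-S) trivial u trivial
  have e2 := hl u trivial S' trivial
  have e3 := hl (-S) trivial S' trivial
  rw [abs_of_nonpos (by linarith)] at e1 e2 e3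
  have t1 := dist_triangle4 P (l (-S)) (l u) x
  have t2 := dist_triangle4 x (l u) (l S') Q
  have t3 := dist_triangle4 (l (-S)) P Q (l S')
  rw [dist_comm (l u) x] at t1
  rw [dist_comm (l S') Q] at t2
  rw [dist_comm (l (-S)) P] at t3
  linarith

/-- Bound on the diameter of the set of `K`-centers of one ideal triangle. -/
theorem IsIdealTriangle.dist_le (hX : IsGeodesicSpace X) {p : X} {N : MorseGauge}
    {α β γ : ℝ → X} {a b c : MorseBoundary p} (h : IsIdealTriangle α β γ a b c)
    (hα : IsMorseGeod N α univ) (hβ : IsMorseGeod N β univ) (hγ : IsMorseGeod N γ univ)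
    {x y : X} {K r s t r' s' t' : ℝ}
    (hr : dist x (α r) ≤ K) (hs : dist x (β s) ≤ K) (ht : dist x (γ t) ≤ K)
    (hr' : dist y (α r') ≤ K) (hs' : dist y (β s') ≤ K) (ht' : dist y (γ t') ≤ K) :
    dist x y ≤ 7 * K + 8 * gaugeVal N 7 2 := by
  obtain ⟨h1, h2, h3⟩ := h
  have hd := gaugeVal_nonneg N 7 2
  -- The vertices are replaced by points beyond parameter `R`, so that all feet of `x` and `y` lie
  -- between them.
  obtain ⟨R, hR⟩ : ∃ R, ∀ u ∈ ({r, s, t, r', s', t'} : Set ℝ), |u| ≤ R := by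
    obtain ⟨R, hR⟩ := ((Set.toFinite ({r, s, t, r', s', t'} : Set ℝ)).image abs).bddAbove
    exact ⟨R, fun u hu => hR (mem_image_of_mem _ hu)⟩
  simp only [mem_insert_iff, mem_singleton_iff, forall_eq_or_imp, forall_eq, abs_le] at hR
  obtain ⟨hr1, hs1, ht1, hr2, hs2, ht2⟩ := hR
  obtain ⟨S₁, hS₁, S₂, hS₂, hA⟩ := (h1.endsAt_left.par h3.endsAt_right).exists_far_near hX
    (hα.comp_neg.geodesic.mono (subset_univ _)) (hγ.mono (subset_univ _) ordConnected_Ici) R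
  obtain ⟨S₃, hS₃, S₄, hS₄, hB⟩ := (h2.endsAt_left.par h1.endsAt_right).exists_far_near hX
    (hβ.comp_neg.geodesic.mono (subset_univ _)) (hα.mono (subset_univ _) ordConnected_Ici) R
  obtain ⟨S₅, hS₅, S₆, hS₆, hC⟩ := (h3.endsAt_left.par h2.endsAt_right).exists_far_near hX
    (hγ.comp_neg.geodesic.mono (subset_univ _)) (hβ.mono (subset_univ _) ordConnected_Ici) R
  have hA' : dist (α (-S₁)) (α (-S₁)) ≤ gaugeVal N 7 2 := by simpa using hd
  have hB' : dist (β (-S₃)) (β (-S₃)) ≤ gaugeVal N 7 2 := by simpa using hd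
  have hC' : dist (γ (-S₅)) (γ (-S₅)) ≤ gaugeVal N 7 2 := by simpa using hd
  -- Both `x` and `y` nearly realize the three distances between the truncated vertices. Their
  -- distances to a vertex are thus nearly determined as Gromov products; comparing positions along
  -- `α` then bounds `dist x y`.
  have x1 := dist_add_dist_le_of_near_line hα.geodesic hA' hB hr (by linarith) (by linarith)
  have x2 := dist_add_dist_le_of_near_line hβ.geodesic hB' hC hs (by linarith) (by linarith)
  have x3 := dist_add_dist_le_of_near_line hγ.geodesic hC' hA ht (by linarith) (by linarith)
  have y1 := dist_add_dist_le_of_near_line hα.geodesic hA' hB hr' (by linarith) (by linarith)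
  have y2 := dist_add_dist_le_of_near_line hβ.geodesic hB' hC hs' (by linarith) (by linarith)
  have y3 := dist_add_dist_le_of_near_line hγ.geodesic hC' hA ht' (by linarith) (by linarith)
  have tx1 := dist_triangle (α (-S₁)) x (β (-S₃))
  have tx2 := dist_triangle (β (-S₃)) x (γ (-S₅))
  have tx3 := dist_triangle (γ (-S₅)) x (α (-S₁))
  have ty1 := dist_triangle (α (-S₁)) y (β (-S₃))
  have ty2 := dist_triangle (β (-S₃)) y (γ (-S₅))
  have ty3 := dist_triangle (γ (-S₅)) y (α (-S₁))
  rw [dist_comm x (β _)] at x1 tx1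
  rw [dist_comm x (γ _)] at x2 tx2
  rw [dist_comm x (α _)] at x3 tx3
  rw [dist_comm y (β _)] at y1 ty1
  rw [dist_comm y (γ _)] at y2 ty2
  rw [dist_comm y (α _)] at y3 ty3
  have e1 := hα.geodesic (-S₁) trivial r trivial
  have e2 := hα.geodesic (-S₁) trivial r' trivial
  have e3 := hα.geodesic r trivial r' trivial
  rw [abs_of_nonpos (by linarith)] at e1 e2
  have f1 := dist_triangle_right (α (-S₁)) (α r) x
  have f2 := dist_triangle (α (-S₁)) (α r) x
  have f3 := dist_triangle_right (α (-S₁)) (α r') y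
  have f4 := dist_triangle (α (-S₁)) (α r') y
  rw [dist_comm (α r) x] at f1 f2
  rw [dist_comm (α r') y] at f3 f4
  have f5 := dist_triangle4 x (α r) (α r') y
  rw [dist_comm (α r') y] at f5
  have e4 : |r - r'| ≤ 5 * K + 8 * gaugeVal N 7 2 := by
    rw [abs_le]; constructor <;> linarith
  linarith

/-- A line between the ends of two Morse lines passing near a common point is Morse. -/
theorem IsLineFromTo.isMorseGeod (hX : IsGeodesicSpace X) {p : X} {N : MorseGauge}
    {α l l' : ℝ → X} {a b : MorseBoundary p} (h : IsLineFromTo α a b)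
    (hl : IsMorseGeod N l univ) (hl' : IsMorseGeod N l' univ) (ha : EndsAt l a) (hb : EndsAt l' b)
    {x : X} {K s s' : ℝ} (hs : dist x (l s) ≤ K) (hs' : dist x (l' s') ≤ K) :
    IsMorseGeod (concatGauge (closeGauge N (footConst N K))) α univ := by
  obtain ⟨C₁, hC₁⟩ := h.endsAt_left.par ha
  obtain ⟨C₂, hC₂⟩ := h.endsAt_right.par hb
  obtain ⟨m, hm₁, hm₂⟩ := MorseHHS.exists_foot hX hl hl' h.1
    (fun t ht => ⟨t, trivial, hC₁ t ht⟩) (fun t ht => ⟨t, trivial, hC₂ t ht⟩)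
    (mem_univ s) (mem_univ s') hs hs'
  exact IsMorseGeod.concat hX h.1 (hl.of_near (h.1.mono (subset_univ _)) ordConnected_Iic hm₁)
    (hl'.of_near (h.1.mono (subset_univ _)) ordConnected_Ici hm₂)

/-- Limits of geodesics in proper spaces. -/
theorem exists_limit_line [ProperSpace X] (α : ℕ → ℝ → X)
    (hα : ∀ R, ∀ᶠ n in atTop, IsGeodesicOn (α n) (Icc (-R) R)) {z : X} {B : ℝ}
    (hB : ∀ n, dist (α n 0) z ≤ B) :
    ∃ l : ℝ → X, IsGeodesicOn l univ ∧
      ∀ t, Tendsto (fun n => α n t) (hyperfilter ℕ : Filter ℕ) (𝓝 (l t)) := by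
  -- Limits along one ultrafilter exist at all times simultaneously, so no diagonal extraction is
  -- needed.
  have hle : (hyperfilter ℕ : Filter ℕ) ≤ atTop := Nat.hyperfilter_le_atTop
  have hex : ∀ t, ∃ y, Tendsto (fun n => α n t) (hyperfilter ℕ : Filter ℕ) (𝓝 y) := by
    intro t
    have hmem : ∀ᶠ n in (hyperfilter ℕ : Filter ℕ), α n t ∈ Metric.closedBall z (|t| + B) := by
      filter_upwards [hle (hα |t|)] with n hn
      have h1 := hn t ⟨neg_abs_le t, le_abs_self t⟩ 0 ⟨by simp, by simp⟩
      rw [sub_zero] at h1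
      exact Metric.mem_closedBall.2 ((dist_triangle _ (α n 0) _).trans (by linarith [hB n]))
    obtain ⟨y, -, hy⟩ := (isCompact_closedBall z (|t| + B)).ultrafilter_le_nhds
      ((hyperfilter ℕ).map fun n => α n t) (le_principal_iff.2 hmem)
    exact ⟨y, hy⟩
  choose l hl using hex
  refine ⟨l, fun s _ t _ => ?_, hl⟩
  refine tendsto_nhds_unique ((hl s).dist (hl t)) (tendsto_const_nhds.congr' ?_)
  filter_upwards [hle (hα (max |s| |t|))] with n hn
  refine (hn s ?_ t ?_).symm
  · exact abs_le.1 (le_max_left _ _)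
  · exact abs_le.1 (le_max_right _ _)

/-- Morse rays that come close arbitrarily far out are parallel. -/
theorem IsMorseGeod.par_of_frequently_near {N : MorseGauge} {r r' : ℝ → X}
    (hr : IsGeodesicOn r (Ici 0)) (hr' : IsMorseGeod N r' (Ici 0)) {E : ℝ}
    (h0 : dist (r 0) (r' 0) ≤ E)
    (h : ∀ R, ∃ s ≥ R, ∃ s', 0 ≤ s' ∧ dist (r s) (r' s') ≤ E) : Par r r' := by
  refine par_of_near hr hr'.geodesic (C := gaugeVal N 1 (0 + 2 * E) + E) fun t ht => ?_
  obtain ⟨s, hs, s', hs', hd⟩ := h t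
  obtain ⟨v, hv, hdv⟩ := hr'.near le_rfl le_rfl self_mem_Ici (mem_Ici.2 hs') (ht.trans hs)
    (hr.mono Icc_subset_Ici_self).isQuasiGeodesicOn h0 hd t ⟨ht, hs⟩
  exact ⟨v, hr'.ordConnected.uIcc_subset self_mem_Ici (mem_Ici.2 hs') hv, hdv⟩

/-- Distinct points of the Morse boundary are joined by a line. -/
theorem exists_isLineFromTo [ProperSpace X] (hX : IsGeodesicSpace X) {p : X}
    {a b : MorseBoundary p} (hab : a ≠ b) : ∃ γ, IsLineFromTo γ a b := by
  obtain ⟨N₁, ρ, hρa, hρ⟩ := a.2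
  obtain ⟨N₂, ρ', hρb, hρ'⟩ := b.2
  have hm := (hρ.isMorseGeod ordConnected_Ici).mono_gauge (le_sup_left : N₁ ≤ N₁ ⊔ N₂)
  have hm' := (hρ'.isMorseGeod ordConnected_Ici).mono_gauge (le_sup_right : N₂ ≤ N₁ ⊔ N₂)
  set N := N₁ ⊔ N₂
  have hnp : ¬ Par ρ.toFun ρ'.toFun := fun hp =>
    hab (Subtype.ext (by rw [← hρa, ← hρb]; exact GeodesicRay.endpoint_eq_iff.2 hp))
  set E := gaugeVal N 3 1 with hE
  have hE0 : 0 ≤ E := gaugeVal_nonneg _ _ _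
  -- Non-parallel Morse rays eventually stay more than `2 * E` apart; this keeps the segments
  -- joining them near `p`.
  obtain ⟨R, hR⟩ : ∃ R, ∀ s ≥ R, ∀ s', 0 ≤ s' → 2 * E < dist (ρ.toFun s) (ρ'.toFun s') := by
    by_contra! hcon
    exact hnp (hm'.par_of_frequently_near ρ.geodesic (by simpa [ρ.base, ρ'.base] using hE0) hcon)
  have hnorm : ∀ (τ : GeodesicRay p) s, 0 ≤ s → dist p (τ.toFun s) = s := fun τ s hs => by
    have := τ.geodesic 0 self_mem_Ici s hs
    rwa [τ.base, zero_sub, abs_neg, abs_of_nonneg hs] at this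
  have hseg : ∀ n : ℕ, ∃ (α : ℝ → X) (u v : ℝ), u ≤ 0 ∧ 0 ≤ v ∧ IsGeodesicOn α (Icc u v) ∧
      (n : ℝ) - (R + E) ≤ -u ∧ (n : ℝ) - (R + E) ≤ v ∧ dist (α 0) p ≤ R + E ∧
      (∀ t ∈ Icc 0 v, dist (α t) (ρ'.toFun t) ≤ R + 3 * E) ∧
      (∀ t ∈ Icc 0 (-u), dist (α (-t)) (ρ.toFun t) ≤ R + 3 * E) := by
    intro n
    have hn : (0 : ℝ) ≤ n := n.cast_nonneg
    obtain ⟨_, α, hα, hα0, hα1, -⟩ := hX (ρ.toFun n) (ρ'.toFun n)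
    set L := dist (ρ.toFun n) (ρ'.toFun n)
    have hL : 0 ≤ L := dist_nonneg
    obtain ⟨m, hmL, hmn⟩ := exists_almost_nearest α (nonempty_Icc.2 hL) p
    have near₁ : ∀ t ∈ Icc 0 m, ∃ s, 0 ≤ s ∧ dist (α t) (ρ.toFun s) ≤ E := by
      intro t ht
      obtain ⟨s, hs, hd⟩ := hm.spike_near_right hX le_rfl le_rfl (mem_Ici.2 hn) self_mem_Ici hmL.1
        (hα.mono (Icc_subset_Icc_right hmL.2)).isQuasiGeodesicOn (w := p) (D := 0)
        (fun s hs => hmn s ⟨hs.1, hs.2.trans hmL.2⟩) (by simp [hα0]) (by simp [ρ.base]) t ht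
      refine ⟨s, ordConnected_Ici.uIcc_subset (mem_Ici.2 hn) self_mem_Ici hs, ?_⟩
      norm_num at hd; exact hd
    have near₂ : ∀ t ∈ Icc m L, ∃ s, 0 ≤ s ∧ dist (α t) (ρ'.toFun s) ≤ E := by
      intro t ht
      obtain ⟨s, hs, hd⟩ := hm'.spike_near_left hX le_rfl le_rfl self_mem_Ici (mem_Ici.2 hn) hmL.2
        (hα.mono (Icc_subset_Icc_left hmL.1)).isQuasiGeodesicOn (w := p) (D := 0)
        (fun s hs => hmn s ⟨hmL.1.trans hs.1, hs.2⟩) (by simp [ρ'.base]) (by simp [hα1]) t ht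
      refine ⟨s, ordConnected_Ici.uIcc_subset self_mem_Ici (mem_Ici.2 hn) hs, ?_⟩
      norm_num at hd; exact hd
    -- The foot of `p` is within `E` of both rays, so those two ray points are within `2 * E` of
    -- each other and the one on `ρ` comes before `R`.
    have hpm : dist (α m) p ≤ R + E := by
      obtain ⟨s, hs, hd⟩ := near₁ m ⟨hmL.1, le_rfl⟩
      obtain ⟨s', hs', hd'⟩ := near₂ m ⟨le_rfl, hmL.2⟩
      have h1 : s < R := by
        by_contra! hcon
        have := hR s hcon s' hs'
        have := dist_triangle_left (ρ.toFun s) (ρ'.toFun s') (α m)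
        linarith
      have h2 := dist_triangle_right (α m) p (ρ.toFun s)
      rw [hnorm ρ s hs] at h2
      linarith
    have fellow : ∀ (τ : GeodesicRay p) (q : X) (t s : ℝ), 0 ≤ t → 0 ≤ s → dist (α m) q = t →
        dist q (τ.toFun s) ≤ E → dist q (τ.toFun t) ≤ R + 3 * E := by
      intro τ q t s ht hs hq hd
      have h1 := hnorm τ s hs
      have h2 := τ.geodesic s hs t ht
      have h3 := dist_triangle4 p (α m) q (τ.toFun s)
      have h4 := dist_triangle4 (α m) p (τ.toFun s) q
      rw [dist_comm p (α m)] at h3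
      rw [dist_comm (τ.toFun s) q] at h4
      have h5 : |s - t| ≤ R + 2 * E := by
        rw [abs_le]; constructor <;> linarith
      have h6 := dist_triangle q (τ.toFun s) (τ.toFun t)
      linarith
    refine ⟨fun t => α (m + t), 0 - m, L - m, by linarith [hmL.1], by linarith [hmL.2], ?_, ?_, ?_,
      by simpa using hpm, ?_, ?_⟩
    · exact hα.comp (fun t ht => ⟨by linarith [ht.1], by linarith [ht.2]⟩)
        fun s t => by congr 1; ring
    · have h1 := hα 0 ⟨le_rfl, hL⟩ m hmL
      rw [hα0, zero_sub, abs_neg, abs_of_nonneg hmL.1] at h1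
      have h2 := dist_triangle_right p (ρ.toFun n) (α m)
      have h3 := dist_triangle p (α m) (ρ.toFun n)
      rw [hnorm ρ n hn, dist_comm p, dist_comm (α m) (ρ.toFun n)] at h3
      linarith
    · have h1 := hα m hmL L ⟨hL, le_rfl⟩
      rw [hα1, abs_of_nonpos (by linarith [hmL.2])] at h1
      have h3 := dist_triangle p (α m) (ρ'.toFun n)
      rw [hnorm ρ' n hn, dist_comm p] at h3
      linarith
    · intro t ht
      obtain ⟨s, hs, hd⟩ := near₂ (m + t) ⟨by linarith [ht.1], by linarith [ht.2]⟩
      refine fellow ρ' _ t s ht.1 hs ?_ hd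
      rw [hα m hmL (m + t) ⟨by linarith [ht.1, hmL.1], by linarith [ht.2]⟩,
        show m - (m + t) = -t by ring, abs_neg, abs_of_nonneg ht.1]
    · intro t ht
      obtain ⟨s, hs, hd⟩ := near₁ (m + -t) ⟨by linarith [ht.2], by linarith [ht.1]⟩
      refine fellow ρ _ t s ht.1 hs ?_ hd
      rw [hα m hmL (m + -t) ⟨by linarith [ht.2], by linarith [ht.1, hmL.2]⟩,
        show m - (m + -t) = t by ring, abs_of_nonneg ht.1]
  choose α u v hu hv hα hnu hnv hp hρ₂ hρ₁ using hseg
  have hlarge : ∀ T : ℝ, ∀ᶠ n : ℕ in atTop, T ≤ -u n ∧ T ≤ v n := by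
    intro T
    filter_upwards [tendsto_natCast_atTop_atTop.eventually_ge_atTop (T + (R + E))] with n hn
    exact ⟨by linarith [hnu n], by linarith [hnv n]⟩
  obtain ⟨l, hl, hlim⟩ := exists_limit_line α (fun T => (hlarge T).mono fun n hn =>
    (hα n).mono (Icc_subset_Icc (by linarith) hn.2)) hp
  have hle : (hyperfilter ℕ : Filter ℕ) ≤ atTop := Nat.hyperfilter_le_atTop
  refine ⟨l, isLineFromTo_iff.2 ⟨hl, ⟨ρ, hρa, R + 3 * E, fun t ht => ?_⟩,
    ⟨ρ', hρb, R + 3 * E, fun t ht => ?_⟩⟩⟩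
  · refine le_of_tendsto ((hlim (-t)).dist tendsto_const_nhds) ?_
    filter_upwards [hle (hlarge t)] with n hn using hρ₁ n t ⟨ht, hn.1⟩
  · refine le_of_tendsto ((hlim t).dist tendsto_const_nhds) ?_
    filter_upwards [hle (hlarge t)] with n hn using hρ₂ n t ⟨ht, hn.2⟩

end IdealGeometry

/-! ### Centers of triples and cross-ratio estimates. -/

section Centers

variable {X : Type u} [MetricSpace X]

/-- The point `x` lies within `K` of some line from `a` to `b`. -/
def NearLine {p : X} (x : X) (K : ℝ) (a b : MorseBoundary p) : Prop :=
  ∃ l : ℝ → X, IsLineFromTo l a b ∧ ∃ t, dist x (l t) ≤ K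

theorem NearLine.symm {p x : X} {K : ℝ} {a b : MorseBoundary p} (h : NearLine x K a b) :
    NearLine x K b a := by
  obtain ⟨l, hl, t, ht⟩ := h
  exact ⟨_, hl.reverse, -t, by simpa using ht⟩

theorem nearLine_comm {p x : X} {K : ℝ} {a b : MorseBoundary p} :
    NearLine x K a b ↔ NearLine x K b a := ⟨NearLine.symm, NearLine.symm⟩

theorem NearLine.of_dist_le {p x y : X} {K K' : ℝ} {a b : MorseBoundary p}
    (h : NearLine x K a b) (hK : dist y x + K ≤ K') : NearLine y K' a b := by
  obtain ⟨l, hl, t, ht⟩ := h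
  exact ⟨l, hl, t, (dist_triangle _ x _).trans (by linarith)⟩

theorem NearLine.mono {p x : X} {K K' : ℝ} {a b : MorseBoundary p}
    (h : NearLine x K a b) (hK : K ≤ K') : NearLine x K' a b := h.of_dist_le (by simpa using hK)

/-- The three sides can be chosen independently, so being a center is a condition on pairs of
vertices. -/
theorem mem_centers_iff {p x : X} {K : ℝ} {a b c : MorseBoundary p} :
    x ∈ centers K a b c ↔ NearLine x K a b ∧ NearLine x K b c ∧ NearLine x K c a := by
  constructor
  · rintro ⟨α, β, γ, ⟨h1, h2, h3⟩, h4, h5, h6⟩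
    exact ⟨⟨α, h1, h4⟩, ⟨β, h2, h5⟩, ⟨γ, h3, h6⟩⟩
  · rintro ⟨⟨α, h1, h4⟩, ⟨β, h2, h5⟩, ⟨γ, h3, h6⟩⟩
    exact ⟨α, β, γ, ⟨h1, h2, h3⟩, h4, h5, h6⟩

theorem mem_centers_iff_forall {p x : X} {K : ℝ} {A : Fin 3 → MorseBoundary p} :
    x ∈ centers K (A 0) (A 1) (A 2) ↔ ∀ i j, i ≠ j → NearLine x K (A i) (A j) := by
  rw [mem_centers_iff]
  constructor
  · rintro ⟨h1, h2, h3⟩ i j hij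
    fin_cases i <;> fin_cases j <;>
      first | exact absurd rfl hij | assumption | (apply NearLine.symm; assumption)
  · exact fun h => ⟨h _ _ (by decide), h _ _ (by decide), h _ _ (by decide)⟩

theorem centers_rotate {p : X} {K : ℝ} (a b c : MorseBoundary p) :
    centers K a b c = centers K b c a := by
  ext x; rw [mem_centers_iff, mem_centers_iff]; tauto

theorem centers_swap {p : X} {K : ℝ} (a b c : MorseBoundary p) :
    centers K a b c = centers K b a c := by
  ext x
  rw [mem_centers_iff, mem_centers_iff, nearLine_comm (a := b) (b := a),
    nearLine_comm (a := a) (b := c), nearLine_comm (a := c) (b := b)]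
  tauto

theorem mem_centers_of_dist_le {p x y : X} {K K' : ℝ} {a b c : MorseBoundary p}
    (h : x ∈ centers K a b c) (hK : dist y x + K ≤ K') : y ∈ centers K' a b c := by
  rw [mem_centers_iff] at h ⊢
  exact ⟨h.1.of_dist_le hK, h.2.1.of_dist_le hK, h.2.2.of_dist_le hK⟩

theorem centers_mono {p : X} {K K' : ℝ} (hK : K ≤ K') (a b c : MorseBoundary p) :
    centers K a b c ⊆ centers K' a b c := fun _ h => mem_centers_of_dist_le h (by simpa using hK)

/-- Distinct points such that all lines between them are `N`-Morse. -/
def MorsePair {p : X} (N : MorseGauge) (a b : MorseBoundary p) : Prop :=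
  a ≠ b ∧ ∀ l : ℝ → X, IsLineFromTo l a b → IsMorseGeod N l univ

theorem MorsePair.symm {p : X} {N : MorseGauge} {a b : MorseBoundary p} (h : MorsePair N a b) :
    MorsePair N b a :=
  ⟨h.1.symm, fun l hl => by simpa using (h.2 _ hl.reverse).comp_neg⟩

theorem MorsePair.mono {p : X} {N N' : MorseGauge} (hN : N ≤ N') {a b : MorseBoundary p}
    (h : MorsePair N a b) : MorsePair N' a b := ⟨h.1, fun l hl => (h.2 l hl).mono_gauge hN⟩

theorem mem_morseTuples_iff {p : X} {n : ℕ} {N : MorseGauge} {x : Fin n → MorseBoundary p} :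
    x ∈ morseTuples p n N ↔ ∀ i j, i ≠ j → MorsePair N (x i) (x j) := by
  constructor
  · exact fun h i j hij => ⟨fun hx => hij (h.1 hx), fun l hl =>
      isMorseGeodesicOn_univ_iff.1 (h.2 i j hij l hl)⟩
  · refine fun h => ⟨fun i j hij => ?_, fun i j hij l hl =>
      isMorseGeodesicOn_univ_iff.2 ((h i j hij).2 l hl)⟩
    by_contra hne
    exact (h i j hne).1 hij

theorem morseTuples_mono {p : X} {n : ℕ} {N N' : MorseGauge} (hN : N ≤ N') :
    morseTuples p n N ⊆ morseTuples p n N' := fun x hx => by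
  rw [mem_morseTuples_iff] at hx ⊢
  exact fun i j hij => (hx i j hij).mono hN

theorem quadruple_mem_morseTuples {p : X} {N : MorseGauge} {a b c d : MorseBoundary p}
    (hab : MorsePair N a b) (hac : MorsePair N a c) (had : MorsePair N a d)
    (hbc : MorsePair N b c) (hbd : MorsePair N b d) (hcd : MorsePair N c d) :
    ![a, b, c, d] ∈ morseTuples p 4 N := by
  rw [mem_morseTuples_iff]
  intro i j hij
  fin_cases i <;> fin_cases j <;>
    first | exact absurd rfl hij | assumption | (apply MorsePair.symm; assumption)

/-- Bound on the diameter of the `K`-centers of a triple in `∂X^(3,N)`. -/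
noncomputable def centersDiam (N : MorseGauge) (K : ℝ) : ℝ :=
  7 * (K + gaugeVal N 7 2) + 8 * gaugeVal N 7 2

theorem dist_le_of_mem_centers (hX : IsGeodesicSpace X) {p : X} {N : MorseGauge}
    {a b c : MorseBoundary p} (hab : MorsePair N a b) (hbc : MorsePair N b c)
    (hca : MorsePair N c a) {K : ℝ} {x y : X} (hx : x ∈ centers K a b c)
    (hy : y ∈ centers K a b c) : dist x y ≤ centersDiam N K := by
  have hN := gaugeVal_nonneg N 7 2
  obtain ⟨⟨α, h1, r, hr⟩, ⟨β, h2, s, hs⟩, ⟨γ, h3, t, ht⟩⟩ := mem_centers_iff.1 hx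
  -- The point `y` may be a center through another triangle; lines with the same ends are `gaugeVal
  -- N 7 2`-close, so it is moved to the triangle used for `x`.
  have shift : ∀ {u v : MorseBoundary p} {l : ℝ → X}, MorsePair N u v → IsLineFromTo l u v →
      NearLine y K u v → ∃ t, dist y (l t) ≤ K + gaugeVal N 7 2 := by
    rintro u v l huv hl ⟨l', hl', t, ht⟩
    obtain ⟨s, hs⟩ := (huv.2 l hl).near_of_par hX hl'.1 (hl'.endsAt_right.par hl.endsAt_right)
      (hl'.endsAt_left.par hl.endsAt_left) t
    exact ⟨s, (dist_triangle _ _ _).trans (add_le_add ht hs)⟩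
  rw [mem_centers_iff] at hy
  obtain ⟨r', hr'⟩ := shift hab h1 hy.1
  obtain ⟨s', hs'⟩ := shift hbc h2 hy.2.1
  obtain ⟨t', ht'⟩ := shift hca h3 hy.2.2
  exact IsIdealTriangle.dist_le hX ⟨h1, h2, h3⟩ (hab.2 α h1) (hbc.2 β h2) (hca.2 γ h3)
    (hr.trans (by linarith)) (hs.trans (by linarith)) (ht.trans (by linarith)) hr' hs' ht'

theorem centers_nonempty [ProperSpace X] (hX : IsGeodesicSpace X) {p : X} {N : MorseGauge}
    {a b c : MorseBoundary p} (hab : MorsePair N a b) (hbc : MorsePair N b c)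
    (hca : MorsePair N c a) : (centers (centerConst p N) a b c).Nonempty := by
  obtain ⟨α, hα⟩ := exists_isLineFromTo hX hab.1
  obtain ⟨β, hβ⟩ := exists_isLineFromTo hX hbc.1
  obtain ⟨γ, hγ⟩ := exists_isLineFromTo hX hca.1
  obtain ⟨h0, hK⟩ := centerConst_spec hX p N
  obtain ⟨r, s, t, h1, h2, h3⟩ := hK a b c α β γ ⟨hα, hβ, hγ⟩
    (isMorseGeodesicOn_univ_iff.2 (hab.2 α hα)) (isMorseGeodesicOn_univ_iff.2 (hbc.2 β hβ))
    (isMorseGeodesicOn_univ_iff.2 (hca.2 γ hγ))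
  exact ⟨α r, α, β, γ, ⟨hα, hβ, hγ⟩, ⟨r, by simpa using h0⟩, ⟨s, h1⟩,
    ⟨t, by rwa [dist_comm]⟩⟩

theorem crossRatio_le (hX : IsGeodesicSpace X) {p : X} {N : MorseGauge}
    {a b c d : MorseBoundary p} (hab : MorsePair N a b) (hbc : MorsePair N b c)
    (hca : MorsePair N c a) (had : MorsePair N a d) (hdc : MorsePair N d c) {K : ℝ} {x : X}
    (hx : x ∈ centers K a b c) (hx' : x ∈ centers K a d c) :
    (crossRatio N a b c d : ℝ) ≤ 2 * centersDiam N (max K (centerConst p N)) := by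
  set M := max K (centerConst p N)
  have key : ∀ y ∈ centers (centerConst p N) a b c ∪ centers (centerConst p N) a d c,
      dist y x ≤ centersDiam N M := by
    rintro y (hy | hy)
    · exact dist_le_of_mem_centers hX hab hbc hca (centers_mono (le_max_right _ _) _ _ _ hy)
        (centers_mono (le_max_left _ _) _ _ _ hx)
    · exact dist_le_of_mem_centers hX had hdc hca (centers_mono (le_max_right _ _) _ _ _ hy)
        (centers_mono (le_max_left _ _) _ _ _ hx')
  have h0 : 0 ≤ centersDiam N M := dist_nonneg.trans
    (dist_le_of_mem_centers hX hab hbc hca (centers_mono (le_max_left _ _) _ _ _ hx)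
      (centers_mono (le_max_left _ _) _ _ _ hx))
  refine Metric.diam_le_of_forall_dist_le (by linarith) fun y hy z hz => ?_
  have h1 := key y hy
  have h2 := key z hz
  have h3 := dist_triangle_right y z x
  linarith

theorem dist_le_crossRatio (hX : IsGeodesicSpace X) {p : X} {N : MorseGauge}
    {a b c d : MorseBoundary p} (hab : MorsePair N a b) (hbc : MorsePair N b c)
    (hca : MorsePair N c a) (had : MorsePair N a d) (hdc : MorsePair N d c) {x y : X}
    (hx : x ∈ centers (centerConst p N) a b c) (hy : y ∈ centers (centerConst p N) a d c) :
    dist x y ≤ crossRatio N a b c d := by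
  -- `Metric.diam` is `0` on unbounded sets, so boundedness of both sets of centers is essential
  -- here.
  refine Metric.dist_le_diam_of_mem (Bornology.IsBounded.union ?_ ?_) (Or.inl hx) (Or.inr hy)
  · exact Metric.isBounded_iff.2 ⟨_, fun u hu v hv => dist_le_of_mem_centers hX hab hbc hca hu hv⟩
  · exact Metric.isBounded_iff.2 ⟨_, fun u hu v hv => dist_le_of_mem_centers hX had hdc hca hu hv⟩

/-- The point `x` lies within `K` of an `N`-Morse line ending at `a`. -/
def NearMorseEnd {p : X} (N : MorseGauge) (K : ℝ) (x : X) (a : MorseBoundary p) : Prop :=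
  ∃ l : ℝ → X, IsMorseGeod N l univ ∧ EndsAt l a ∧ ∃ s, dist x (l s) ≤ K

/-- Gauge of the lines between ends of `N`-Morse lines passing within `K` of a common point. -/
noncomputable def endsGauge (N : MorseGauge) (K : ℝ) : MorseGauge :=
  concatGauge (closeGauge N (footConst N K))

/-- It supplies one gauge for all the mixed triples formed from two triples with a common center. -/
theorem NearMorseEnd.morsePair (hX : IsGeodesicSpace X) {p : X} {N : MorseGauge} {K : ℝ} {x : X}
    {a b : MorseBoundary p} (ha : NearMorseEnd N K x a) (hb : NearMorseEnd N K x b)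
    (hab : a ≠ b) : MorsePair (endsGauge N K) a b := by
  obtain ⟨l, hl, hla, s, hs⟩ := ha
  obtain ⟨l', hl', hlb, s', hs'⟩ := hb
  exact ⟨hab, fun α hα => hα.isMorseGeod hX hl hl' hla hlb hs hs'⟩

theorem NearLine.nearMorseEnd {p : X} {N : MorseGauge} {K : ℝ} {x : X}
    {a b : MorseBoundary p} (h : NearLine x K a b) (hab : MorsePair N a b) :
    NearMorseEnd N K x b := by
  obtain ⟨l, hl, s, hs⟩ := h
  exact ⟨l, hab.2 l hl, hl.endsAt_right, s, hs⟩

/-- Slimness: a point near a line from `a` to `c` is near a line from `a` to `b` or near a line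
from `b` to `c`. -/
theorem NearLine.near_or_near [ProperSpace X] (hX : IsGeodesicSpace X) {p : X} {N : MorseGauge}
    {K : ℝ} {x : X} {a b c : MorseBoundary p} (h : NearLine x K a c) (hac : a ≠ c)
    (hab : a ≠ b → MorsePair N a b) (hbc : b ≠ c → MorsePair N b c) :
    (a ≠ b ∧ NearLine x (K + slimConst N) a b) ∨ (b ≠ c ∧ NearLine x (K + slimConst N) b c) := by
  have h0 := slimConst_nonneg N
  by_cases h1 : a = b
  · subst h1
    exact Or.inr ⟨hac, h.mono (by linarith)⟩
  by_cases h2 : b = c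
  · subst h2
    exact Or.inl ⟨hac, h.mono (by linarith)⟩
  obtain ⟨l, hl, t, ht⟩ := h
  obtain ⟨γ, hγ⟩ := exists_isLineFromTo hX h1
  obtain ⟨β, hβ⟩ := exists_isLineFromTo hX h2
  obtain ⟨m, hm₁, hm₂⟩ := IsIdealTriangle.exists_foot hX ⟨hl, hβ.reverse, hγ.reverse⟩
    (((hbc h2).2 β hβ).comp_neg) (((hab h1).2 γ hγ).comp_neg)
  rcases le_total t m with htm | htm
  · obtain ⟨s, hs⟩ := hm₁ t htm
    exact Or.inl ⟨h1, γ, hγ, -s, (dist_triangle _ _ _).trans (add_le_add ht hs)⟩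
  · obtain ⟨s, hs⟩ := hm₂ t htm
    exact Or.inr ⟨h2, β, hβ, -s, (dist_triangle _ _ _).trans (add_le_add ht hs)⟩

end Centers

/-! ### Matching the vertices of two triples. -/

/-- A `3 × 3` relation with at most one missing entry in every row and every column contains, up to
a permutation of the columns, all the off-diagonal entries. -/
theorem exists_perm_offDiag (B : Fin 3 → Fin 3 → Prop)
    (hrow : ∀ i j k, j ≠ k → B i j ∨ B i k) (hcol : ∀ i j k, i ≠ k → B i j ∨ B k j) :
    ∃ σ : Equiv.Perm (Fin 3), ∀ i j, i ≠ j → B i (σ j) := by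
  -- The missing entries form a partial matching of rows with columns; a permutation extending it
  -- puts them all on the diagonal. The six permutations are checked exhaustively.
  have key : ∃ a b c : Fin 3, (a ≠ b ∧ b ≠ c ∧ a ≠ c) ∧
      (B 1 a ∧ B 2 a) ∧ (B 0 b ∧ B 2 b) ∧ B 0 c ∧ B 1 c := by
    by_contra! hcon
    have r := fun i => And.intro (hrow i 0 1 (by decide))
      (And.intro (hrow i 1 2 (by decide)) (hrow i 0 2 (by decide)))
    have c := fun j => And.intro (hcol 0 j 1 (by decide))
      (And.intro (hcol 1 j 2 (by decide)) (hcol 0 j 2 (by decide)))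
    have h1 := hcon 0 1 2 (by decide)
    have h2 := hcon 0 2 1 (by decide)
    have h3 := hcon 1 0 2 (by decide)
    have h4 := hcon 1 2 0 (by decide)
    have h5 := hcon 2 0 1 (by decide)
    have h6 := hcon 2 1 0 (by decide)
    have r0 := r 0
    have r1 := r 1
    have r2 := r 2
    have c0 := c 0
    have c1 := c 1
    have c2 := c 2
    clear hcon r c hrow hcol
    grind
  obtain ⟨a, b, c, ⟨hab, hbc, hac⟩, ⟨h1, h2⟩, ⟨h3, h4⟩, h5, h6⟩ := key
  have hinj : Function.Injective ![a, b, c] := by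
    intro i j hij
    fin_cases i <;> fin_cases j <;> simp_all
  refine ⟨Equiv.ofBijective _ (Finite.injective_iff_bijective.1 hinj), fun i j hij => ?_⟩
  fin_cases i <;> fin_cases j <;> first | exact absurd rfl hij | assumption

/-! ### The map induced on the interior and its coarse control. -/

section QuasiMobius

variable {X : Type u} [MetricSpace X] {Y : Type v} [MetricSpace Y] {p : X} {q : Y}
  {h : MorseBoundary p → MorseBoundary q}

theorem MapsPairs.morsePair {N N' : MorseGauge} (hN : MapsPairs h N N') {a b : MorseBoundary p}
    (hab : MorsePair N a b) : MorsePair N' (h a) (h b) := by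
  have : ![a, b] ∈ morseTuples p 2 N := by
    rw [mem_morseTuples_iff]
    intro i j hij
    fin_cases i <;> fin_cases j <;>
      first | exact absurd rfl hij | assumption | (apply MorsePair.symm; assumption)
  exact mem_morseTuples_iff.1 (hN _ this) 0 1 (by decide)

/-- If `x` is a center both before and after exchanging one vertex of a triple, then the centers of
the image triples are close. -/
theorem IsQuasiMobius.exists_exchange_bound (hX : IsGeodesicSpace X) (hY : IsGeodesicSpace Y)
    (hh : IsQuasiMobius h) {N N' : MorseGauge} (hN : MapsPairs h N N') (K : ℝ) :
    ∃ D, ∀ (x : X) (a b c d : MorseBoundary p), MorsePair N a b → MorsePair N b c →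
      MorsePair N a c → MorsePair N d b → MorsePair N d c → (a ≠ d → MorsePair N a d) →
      x ∈ centers K a b c → x ∈ centers K d b c →
      ∀ y ∈ centers (centerConst q N') (h a) (h b) (h c),
      ∀ y' ∈ centers (centerConst q N') (h d) (h b) (h c), dist y y' ≤ D := by
  obtain ⟨ψ, -, hψ, hle⟩ := hh N N' hN
  refine ⟨max (ψ (2 * centersDiam N (max K (centerConst p N))).toNNReal)
    (centersDiam N' (centerConst q N')), ?_⟩
  intro x a b c d hab hbc hac hdb hdc had hx hx' y hy y' hy'
  by_cases hd : a = d
  · subst hd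
    exact (dist_le_of_mem_centers hY (hN.morsePair hab) (hN.morsePair hbc)
      (hN.morsePair hac.symm) hy hy').trans (le_max_right _ _)
  · refine le_trans ?_ (le_max_left _ _)
    -- The cross-ratio exchanges its second and fourth entries, so the vertex being replaced is
    -- moved to second place.
    rw [centers_swap] at hx hx' hy hy'
    have h1 := crossRatio_le hX hab.symm hac hbc.symm hdb.symm hdc hx hx'
    have h2 := dist_le_crossRatio hY (hN.morsePair hab.symm) (hN.morsePair hac)
      (hN.morsePair hbc.symm) (hN.morsePair hdb.symm) (hN.morsePair hdc) hy hy'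
    have h3 := hle _ (quadruple_mem_morseTuples hab.symm hbc hdb.symm hac (had hd) hdc.symm)
    have h4 := hψ (NNReal.coe_le_coe.1 (h1.trans (Real.le_coe_toNNReal _)))
    exact h2.trans (NNReal.coe_le_coe.2 (h3.trans h4))

/-- If `x` is a center of two triples, then the centers of the image triples are close. -/
theorem IsQuasiMobius.exists_centers_bound [ProperSpace X] [ProperSpace Y]
    (hX : IsGeodesicSpace X) (hY : IsGeodesicSpace Y) (hs : IsTwoStable h)
    (hh : IsQuasiMobius h) (N : MorseGauge) (K K' : ℝ) :
    ∃ D, ∀ (x : X), ∀ A ∈ morseTuples p 3 N, ∀ A' ∈ morseTuples p 3 N,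
      x ∈ centers K (A 0) (A 1) (A 2) → x ∈ centers K (A' 0) (A' 1) (A' 2) →
      ∀ y ∈ centers K' (h (A 0)) (h (A 1)) (h (A 2)),
      ∀ y' ∈ centers K' (h (A' 0)) (h (A' 1)) (h (A' 2)), dist y y' ≤ D := by
  obtain ⟨N', hN⟩ := hs (endsGauge N K)
  obtain ⟨D, hD⟩ := hh.exists_exchange_bound hX hY hN (K + slimConst (endsGauge N K))
  set M := max K' (centerConst q N') with hM
  refine ⟨centersDiam N' M + 3 * D + centersDiam N' M, ?_⟩
  intro x A hA A' hA' hx hx' y hy y' hy'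
  rw [mem_morseTuples_iff] at hA hA'
  rw [mem_centers_iff_forall] at hx hx'
  have hother : ∀ i : Fin 3, ∃ j, j ≠ i := by decide
  have hend : ∀ i, NearMorseEnd N K x (A i) := fun i => by
    obtain ⟨j, hj⟩ := hother i
    exact (hx j i hj).nearMorseEnd (hA j i hj)
  have hend' : ∀ i, NearMorseEnd N K x (A' i) := fun i => by
    obtain ⟨j, hj⟩ := hother i
    exact (hx' j i hj).nearMorseEnd (hA' j i hj)
  have hK := slimConst_nonneg (endsGauge N K)
  -- Rows: a line between two vertices of `A'` passes near `x`, so by slimness one of them is joined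
  -- to `A i` near `x`. Columns are symmetric.
  obtain ⟨σ, hσ⟩ := exists_perm_offDiag
    (fun i j => A i ≠ A' j ∧ NearLine x (K + slimConst (endsGauge N K)) (A i) (A' j))
    (fun i j k hjk => by
      rcases (hx' j k hjk).near_or_near hX (b := A i) (hA' j k hjk).1
        ((hend' j).morsePair hX (hend i)) ((hend i).morsePair hX (hend' k)) with h1 | h1
      · exact Or.inl ⟨h1.1.symm, h1.2.symm⟩
      · exact Or.inr h1)
    (fun i j k hik => by
      rcases (hx i k hik).near_or_near hX (b := A' j) (hA i k hik).1
        ((hend i).morsePair hX (hend' j)) ((hend' j).morsePair hX (hend k)) with h1 | h1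
      · exact Or.inl h1
      · exact Or.inr ⟨h1.1.symm, h1.2.symm⟩)
  set B : Fin 3 → MorseBoundary p := fun i => A' (σ i) with hB
  have hyB : y' ∈ centers K' (h (B 0)) (h (B 1)) (h (B 2)) := by
    rw [mem_centers_iff_forall (A := fun i => h (B i))]
    rw [mem_centers_iff_forall (A := fun i => h (A' i))] at hy'
    exact fun i j hij => hy' _ _ (σ.injective.ne hij)
  have hAA : ∀ i j, i ≠ j → MorsePair (endsGauge N K) (A i) (A j) ∧
      NearLine x (K + slimConst (endsGauge N K)) (A i) (A j) := fun i j hij =>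
    ⟨(hend i).morsePair hX (hend j) (hA i j hij).1, (hx i j hij).mono (by linarith)⟩
  have hBB : ∀ i j, i ≠ j → MorsePair (endsGauge N K) (B i) (B j) ∧
      NearLine x (K + slimConst (endsGauge N K)) (B i) (B j) := fun i j hij =>
    ⟨(hend' _).morsePair hX (hend' _) (hA' _ _ (σ.injective.ne hij)).1,
      (hx' _ _ (σ.injective.ne hij)).mono (by linarith)⟩
  have hAB : ∀ i j, i ≠ j → MorsePair (endsGauge N K) (A i) (B j) ∧
      NearLine x (K + slimConst (endsGauge N K)) (A i) (B j) := fun i j hij =>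
    ⟨(hend i).morsePair hX (hend' _) (hσ i j hij).1, (hσ i j hij).2⟩
  have hBA : ∀ i j, i ≠ j → MorsePair (endsGauge N K) (B i) (A j) ∧
      NearLine x (K + slimConst (endsGauge N K)) (B i) (A j) := fun i j hij =>
    ⟨(hAB j i hij.symm).1.symm, (hAB j i hij.symm).2.symm⟩
  have hd : ∀ i, A i ≠ B i → MorsePair (endsGauge N K) (A i) (B i) := fun i =>
    (hend i).morsePair hX (hend' _)
  have h01 : (0 : Fin 3) ≠ 1 := by decide
  have h02 : (0 : Fin 3) ≠ 2 := by decide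
  have h12 : (1 : Fin 3) ≠ 2 := by decide
  have nonempty : ∀ {a b c : MorseBoundary p}, MorsePair (endsGauge N K) a b →
      MorsePair (endsGauge N K) b c → MorsePair (endsGauge N K) a c →
      (centers (centerConst q N') (h a) (h b) (h c)).Nonempty := fun hab hbc hac =>
    centers_nonempty hY (hN.morsePair hab) (hN.morsePair hbc) (hN.morsePair hac.symm)
  -- The chain replaces `A 0`, `A 1`, `A 2` in turn by `B 0`, `B 1`, `B 2`; only off-diagonal mixed
  -- pairs occur in it.
  obtain ⟨y₀, hy₀⟩ := nonempty (hAA 0 1 h01).1 (hAA 1 2 h12).1 (hAA 0 2 h02).1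
  obtain ⟨y₁, hy₁⟩ := nonempty (hBA 0 1 h01).1 (hAA 1 2 h12).1 (hBA 0 2 h02).1
  obtain ⟨y₂, hy₂⟩ := nonempty (hBB 0 1 h01).1 (hBA 1 2 h12).1 (hBA 0 2 h02).1
  obtain ⟨y₃, hy₃⟩ := nonempty (hBB 0 1 h01).1 (hBB 1 2 h12).1 (hBB 0 2 h02).1
  have d₀ : dist y y₀ ≤ centersDiam N' M := dist_le_of_mem_centers hY
    (hN.morsePair (hAA 0 1 h01).1) (hN.morsePair (hAA 1 2 h12).1)
    (hN.morsePair (hAA 2 0 h02.symm).1) (centers_mono (le_max_left _ _) _ _ _ hy)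
    (centers_mono (le_max_right _ _) _ _ _ hy₀)
  have d₃ : dist y₃ y' ≤ centersDiam N' M := dist_le_of_mem_centers hY
    (hN.morsePair (hBB 0 1 h01).1) (hN.morsePair (hBB 1 2 h12).1)
    (hN.morsePair (hBB 2 0 h02.symm).1) (centers_mono (le_max_right _ _) _ _ _ hy₃)
    (centers_mono (le_max_left _ _) _ _ _ hyB)
  have d₁ : dist y₀ y₁ ≤ D := hD x (A 0) (A 1) (A 2) (B 0) (hAA 0 1 h01).1 (hAA 1 2 h12).1
    (hAA 0 2 h02).1 (hBA 0 1 h01).1 (hBA 0 2 h02).1 (hd 0)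
    (mem_centers_iff.2 ⟨(hAA 0 1 h01).2, (hAA 1 2 h12).2, (hAA 2 0 h02.symm).2⟩)
    (mem_centers_iff.2 ⟨(hBA 0 1 h01).2, (hAA 1 2 h12).2, (hAB 2 0 h02.symm).2⟩) y₀ hy₀ y₁ hy₁
  have d₂ : dist y₁ y₂ ≤ D := by
    rw [centers_swap] at hy₁ hy₂
    exact hD x (A 1) (B 0) (A 2) (B 1) (hAB 1 0 h01.symm).1 (hBA 0 2 h02).1
      (hAA 1 2 h12).1 (hBB 1 0 h01.symm).1 (hBA 1 2 h12).1 (hd 1)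
      (mem_centers_iff.2 ⟨(hAB 1 0 h01.symm).2, (hBA 0 2 h02).2, (hAA 2 1 h12.symm).2⟩)
      (mem_centers_iff.2 ⟨(hBB 1 0 h01.symm).2, (hBA 0 2 h02).2, (hAB 2 1 h12.symm).2⟩)
      y₁ hy₁ y₂ hy₂
  have d₂' : dist y₂ y₃ ≤ D := by
    rw [← centers_rotate] at hy₂ hy₃
    exact hD x (A 2) (B 0) (B 1) (B 2) (hAB 2 0 h02.symm).1 (hBB 0 1 h01).1
      (hAB 2 1 h12.symm).1 (hBB 2 0 h02.symm).1 (hBB 2 1 h12.symm).1 (hd 2)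
      (mem_centers_iff.2 ⟨(hAB 2 0 h02.symm).2, (hBB 0 1 h01).2, (hBA 1 2 h12).2⟩)
      (mem_centers_iff.2 ⟨(hBB 2 0 h02.symm).2, (hBB 0 1 h01).2, (hBB 1 2 h12).2⟩)
      y₂ hy₂ y₃ hy₃
  have t1 := dist_triangle4 y y₀ y₁ y₂
  have t2 := dist_triangle4 y y₂ y₃ y'
  linarith

/-- A map sending centers of triples to centers of image triples. -/
theorem exists_center_map [ProperSpace Y] (hY : IsGeodesicSpace Y) {N N' : MorseGauge} {K : ℝ}
    (hc : ∀ y : X, ∃ x ∈ morseTuples p 3 N, y ∈ centers K (x 0) (x 1) (x 2))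
    (hN : MapsPairs h N N') :
    ∃ f : X → Y, ∀ x, ∃ A ∈ morseTuples p 3 N, x ∈ centers K (A 0) (A 1) (A 2) ∧
      f x ∈ centers (centerConst q N') (h (A 0)) (h (A 1)) (h (A 2)) := by
  choose A hA hx using hc
  have hne : ∀ x, (centers (centerConst q N') (h (A x 0)) (h (A x 1)) (h (A x 2))).Nonempty := by
    intro x
    have := mem_morseTuples_iff.1 (hA x)
    exact centers_nonempty hY (hN.morsePair (this 0 1 (by decide)))
      (hN.morsePair (this 1 2 (by decide))) (hN.morsePair (this 2 0 (by decide)))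
  choose f hf using hne
  exact ⟨f, fun x => ⟨A x, hA x, hx x, hf x⟩⟩

/-- A center for `x'` is also one for `x` once the constant grows by the distance, so both image
points compare through triples centered at `x`. -/
theorem IsQuasiMobius.exists_dist_map_le [ProperSpace X] [ProperSpace Y]
    (hX : IsGeodesicSpace X) (hY : IsGeodesicSpace Y) (hs : IsTwoStable h)
    (hh : IsQuasiMobius h) {N : MorseGauge} {K K' : ℝ} {f : X → Y}
    (hf : ∀ x, ∃ A ∈ morseTuples p 3 N, x ∈ centers K (A 0) (A 1) (A 2) ∧
      f x ∈ centers K' (h (A 0)) (h (A 1)) (h (A 2))) (R : ℝ) :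
    ∃ D, ∀ x x', dist x x' ≤ R → dist (f x) (f x') ≤ D := by
  obtain ⟨D, hD⟩ := hh.exists_centers_bound hX hY hs N (K + max R 0) K'
  refine ⟨D, fun x x' hxx => ?_⟩
  obtain ⟨A, hA, hxA, hfA⟩ := hf x
  obtain ⟨A', hA', hxA', hfA'⟩ := hf x'
  exact hD x A hA A' hA' (centers_mono (by linarith [le_max_right R 0]) _ _ _ hxA)
    (mem_centers_of_dist_le hxA' (by linarith [le_max_left R 0])) _ hfA _ hfA'

/-- Maps induced by `h` and by its inverse are coarsely inverse to each other. -/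
theorem exists_dist_inverse_le [ProperSpace X] [ProperSpace Y]
    (hX : IsGeodesicSpace X) (hY : IsGeodesicSpace Y) {k : MorseBoundary q → MorseBoundary p}
    (hkh : ∀ a, k (h a) = a) (hs : IsTwoStable k) (hk : IsQuasiMobius k)
    {N N' N'' : MorseGauge} (hN : MapsPairs h N N') {K K' L L' : ℝ} {f : X → Y} {g : Y → X}
    (hf : ∀ x, ∃ A ∈ morseTuples p 3 N, x ∈ centers K (A 0) (A 1) (A 2) ∧
      f x ∈ centers K' (h (A 0)) (h (A 1)) (h (A 2)))
    (hg : ∀ y, ∃ A ∈ morseTuples q 3 N'', y ∈ centers L (A 0) (A 1) (A 2) ∧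
      g y ∈ centers L' (k (A 0)) (k (A 1)) (k (A 2))) :
    ∃ D, ∀ x, dist x (g (f x)) ≤ D := by
  obtain ⟨D, hD⟩ := hk.exists_centers_bound hY hX hs (N' ⊔ N'') (max K' L) (max K L')
  refine ⟨D, fun x => ?_⟩
  obtain ⟨A, hA, hxA, hfA⟩ := hf x
  obtain ⟨A', hA', hyA', hgA'⟩ := hg (f x)
  have hhA : h ∘ A ∈ morseTuples q 3 (N' ⊔ N'') := by
    rw [mem_morseTuples_iff] at hA ⊢
    exact fun i j hij => (hN.morsePair (hA i j hij)).mono le_sup_left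
  -- Both `h ∘ A` and `A'` are centered at `f x`, and `k` sends `h ∘ A` back to `A`, of which `x` is
  -- a center.
  refine hD (f x) (h ∘ A) hhA A' (morseTuples_mono le_sup_right hA')
    (centers_mono (le_max_left _ _) _ _ _ hfA) (centers_mono (le_max_right _ _) _ _ _ hyA') _
    ?_ _ (centers_mono (le_max_right _ _) _ _ _ hgA')
  simp only [Function.comp_apply, hkh]
  exact centers_mono (le_max_left _ _) _ _ _ hxA

/-- On a geodesic space, a map that is bounded at scale one is coarsely Lipschitz. -/
theorem dist_map_le_of_geodesic (hY : IsGeodesicSpace Y) {g : Y → X} {D : ℝ}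
    (hg : ∀ y y', dist y y' ≤ 1 → dist (g y) (g y') ≤ D) (y y' : Y) :
    dist (g y) (g y') ≤ D * dist y y' + D := by
  have hD : 0 ≤ D := dist_nonneg.trans (hg y y (by simp))
  have key : ∀ (n : ℕ) (y y' : Y), dist y y' ≤ n → dist (g y) (g y') ≤ D * n := by
    intro n
    induction n with
    | zero =>
      intro y y' hy
      have : y = y' := dist_le_zero.1 (by simpa using hy)
      simp [this]
    | succ n ih =>
      intro y y' hy
      push_cast at hy ⊢
      obtain ⟨_, γ, hγ, h0, h1, -⟩ := hY y y'
      have hd : 0 ≤ dist y y' := dist_nonneg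
      have hm : min (n : ℝ) (dist y y') ∈ Icc 0 (dist y y') :=
        ⟨le_min n.cast_nonneg hd, min_le_right _ _⟩
      have e1 := hγ 0 ⟨le_rfl, hd⟩ _ hm
      have e2 := hγ _ hm (dist y y') ⟨hd, le_rfl⟩
      rw [h0, abs_of_nonpos (by linarith [hm.1])] at e1
      rw [h1, abs_of_nonpos (by linarith [hm.2])] at e2
      have i1 := ih y (γ (min n (dist y y'))) (by rw [e1]; linarith [min_le_left (n : ℝ) (dist y y')])
      have i2 := hg (γ (min n (dist y y'))) y' (by
        rw [e2]
        have : dist y y' - 1 ≤ min (n : ℝ) (dist y y') := le_min (by linarith) (by linarith)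
        linarith)
      have := dist_triangle (g y) (g (γ (min n (dist y y')))) (g y')
      linarith
  -- Rounding the distance up to an integer costs less than one step, hence the additive `D`.
  have h1 := key ⌈dist y y'⌉₊ y y' (Nat.le_ceil _)
  have h2 := (Nat.ceil_lt_add_one (dist_nonneg (x := y) (y := y'))).le
  nlinarith

end QuasiMobius

/-! ### Pulling back HHS structures. -/

section Transfer

theorem setDist_nonneg {Z : Type z} [MetricSpace Z] (A B : Set Z) : 0 ≤ setDist A B :=
  Real.sInf_nonneg (by rintro _ ⟨a, _, b, _, rfl⟩; exact dist_nonneg)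

theorem setDist_le {Z : Type z} [MetricSpace Z] {A B : Set Z} {a b : Z} (ha : a ∈ A)
    (hb : b ∈ B) : setDist A B ≤ dist a b :=
  csInf_le ⟨0, by rintro _ ⟨a, _, b, _, rfl⟩; exact dist_nonneg⟩ ⟨a, ha, b, hb, rfl⟩

theorem exists_dist_lt_of_setDist_lt {Z : Type z} [MetricSpace Z] {A B : Set Z}
    (hA : A.Nonempty) (hB : B.Nonempty) {r : ℝ} (h : setDist A B < r) :
    ∃ a ∈ A, ∃ b ∈ B, dist a b < r := by
  obtain ⟨a, ha⟩ := hA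
  obtain ⟨b, hb⟩ := hB
  obtain ⟨_, ⟨a, ha, b, hb, rfl⟩, hlt⟩ := exists_lt_of_csInf_lt
    (s := {r : ℝ | ∃ a ∈ A, ∃ b ∈ B, r = dist a b}) ⟨_, a, ha, b, hb, rfl⟩ h
  exact ⟨a, ha, b, hb, hlt⟩

/-- `setDist` is an infimum, so the two nearly closest points of `B` may differ; its diameter bound
`r` pays for this. -/
theorem setDist_triangle {Z : Type z} [MetricSpace Z] {A B C : Set Z} {r : ℝ}
    (hA : A.Nonempty) (hB : B.Nonempty) (hC : C.Nonempty) (hr : DiamLE B r) :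
    setDist A C ≤ setDist A B + r + setDist B C := by
  refine le_of_forall_pos_le_add fun ε hε => ?_
  obtain ⟨a, ha, b, hb, h1⟩ := exists_dist_lt_of_setDist_lt hA hB
    (lt_add_of_pos_right (setDist A B) (half_pos hε))
  obtain ⟨b', hb', c, hc, h2⟩ := exists_dist_lt_of_setDist_lt hB hC
    (lt_add_of_pos_right (setDist B C) (half_pos hε))
  have h3 := hr b hb b' hb'
  have h4 := dist_triangle4 a b b' c
  linarith [setDist_le ha hc]

variable {X : Type u} [MetricSpace X] {Y : Type v} [MetricSpace Y]

attribute [local instance] HHSStructure.order HHSStructure.metric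

/-- Transport of an HHS structure along a coarse equivalence. -/
theorem HHSStructure.nonempty_of_coarseEquiv (H : HHSStructure.{u, w, z} X) [Nonempty X]
    (g : Y → X) {L B : ℝ} (hL : ∀ y y', dist (g y) (g y') ≤ L * dist y y' + L)
    (hB : ∀ x, ∃ y, dist x (g y) ≤ B)
    (hg : ∀ R, ∃ S, ∀ y y', dist (g y) (g y') ≤ R → dist y y' ≤ S) :
    Nonempty (HHSStructure.{v, w, z} Y) := by
  obtain ⟨x₀⟩ := ‹Nonempty X›
  obtain ⟨y₀, hy₀⟩ := hB x₀
  have hB0 : 0 ≤ B := dist_nonneg.trans hy₀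
  have hL0 : 0 ≤ L := by simpa using hL y₀ y₀
  -- The maximal element serves only to provide an index, from which the signs of `H.K` and `H.ξ`
  -- follow.
  obtain ⟨S₀, -, -⟩ := H.exists_unique_max
  have hK0 : 0 ≤ H.K := by
    have := (setDist_nonneg _ _).trans (H.π_lipschitz S₀ x₀ x₀)
    simpa using this
  have hξ0 : 0 ≤ H.ξ := by
    obtain ⟨a, ha⟩ := H.π_nonempty S₀ x₀
    exact dist_nonneg.trans (H.π_diam S₀ x₀ a ha a ha)
  have hclose : ∀ {x : X} {y : Y}, dist x (g y) ≤ B → ∀ W, ∀ a ∈ H.π W x, ∀ b ∈ H.π W (g y),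
      dist a b ≤ H.K * B + H.K + 1 + 2 * H.ξ := by
    intro x y hxy W a ha b hb
    obtain ⟨a', ha', b', hb', hd⟩ := exists_dist_lt_of_setDist_lt (H.π_nonempty W x)
      (H.π_nonempty W (g y)) (lt_add_one _)
    have h1 := H.π_lipschitz W x (g y)
    have h2 := H.π_diam W x a ha a' ha'
    have h3 := H.π_diam W (g y) b' hb' b hb
    have h4 := dist_triangle4 a a' b' b
    have h5 := mul_le_mul_of_nonneg_left hxy hK0
    linarith
  have hmem : ∀ {W} {q : H.C W}, q ∈ ⋃ y, H.π W (g y) → q ∈ ⋃ x, H.π W x := by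
    intro W q hq
    obtain ⟨y, hy⟩ := mem_iUnion.1 hq
    exact mem_iUnion.2 ⟨g y, hy⟩
  refine ⟨{
    Idx := H.Idx
    order := H.order
    C := H.C
    metric := H.metric
    δ := H.δ
    hyperbolic := H.hyperbolic
    -- Only the projections change. Axioms quantifying over all points restrict to the image of `g`;
    -- those asserting that a point exists use that `g` is coarsely onto.
    π := fun W y => H.π W (g y)
    ξ := H.ξ
    -- One constant must serve two axioms: `H.K * L + H.K` comes from the Lipschitz bound, and the
    -- bracket from moving a point of `X` into the image of `g`.
    K := H.K * L + H.K + (H.K * B + H.K + 1 + 2 * H.ξ)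
    π_nonempty := fun W y => H.π_nonempty W (g y)
    π_diam := fun W y => H.π_diam W (g y)
    π_lipschitz := ?lip
    π_quasiconvex := ?qc
    exists_unique_max := H.exists_unique_max
    orth := H.orth
    orth_symm := H.orth_symm
    orth_irrefl := H.orth_irrefl
    orth_of_le := H.orth_of_le
    orth_container := H.orth_container
    orth_not_comparable := H.orth_not_comparable
    ρset := H.ρset
    ρmap := H.ρmap
    ρset_nonempty := H.ρset_nonempty
    ρset_diam := H.ρset_diam
    ρmap_nonempty := H.ρmap_nonempty
    κ₀ := H.κ₀
    consistency_transverse := fun V W h y => H.consistency_transverse V W h (g y)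
    consistency_nested := fun V W h y => H.consistency_nested V W h (g y)
    consistency_ρ := H.consistency_ρ
    complexity := H.complexity
    finite_complexity := H.finite_complexity
    lam := H.lam
    one_le_lam := H.one_le_lam
    E := H.E
    E_pos := H.E_pos
    ξ_le_E := H.ξ_le_E
    κ₀_le_E := H.κ₀_le_E
    large_links := fun W y y' => H.large_links W (g y) (g y')
    bounded_geodesic_image := H.bounded_geodesic_image
    α := H.K * B + H.K + H.ξ + H.α
    partial_realization := ?pr
    uniqueness := ?un }⟩
  case lip =>
    intro W y y'
    have h1 := H.π_lipschitz W (g y) (g y')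
    have h2 := mul_le_mul_of_nonneg_left (hL y y') hK0
    have h3 : 0 ≤ H.K * B := mul_nonneg hK0 hB0
    have h4 : 0 ≤ dist y y' := dist_nonneg
    have h5 : 0 ≤ (H.K + (H.K * B + H.K + 1 + 2 * H.ξ)) * dist y y' := by positivity
    linarith
  case qc =>
    intro W a ha b hb s hs q hq
    obtain ⟨q', hq', hd⟩ := H.π_quasiconvex W a (hmem ha) b (hmem hb) s hs q hq
    obtain ⟨x, hx⟩ := mem_iUnion.1 hq'
    obtain ⟨y, hy⟩ := hB x
    obtain ⟨c, hc⟩ := H.π_nonempty W (g y)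
    refine ⟨c, mem_iUnion.2 ⟨y, hc⟩, (dist_triangle _ q' _).trans ?_⟩
    have h1 := hclose hy W q' hx c hc
    have h2 : 0 ≤ H.K * L := mul_nonneg hK0 hL0
    linarith
  case pr =>
    intro A hA p hp
    obtain ⟨x, hx⟩ := H.partial_realization A hA p fun V hV => hmem (hp V hV)
    obtain ⟨y, hy⟩ := hB x
    have hmove : ∀ W, ∀ T : Set (H.C W), T.Nonempty → setDist (H.π W x) T ≤ H.α →
        setDist (H.π W (g y)) T ≤ H.K * B + H.K + H.ξ + H.α := by
      intro W T hT hα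
      have h1 := setDist_triangle (H.π_nonempty W (g y)) (H.π_nonempty W x) hT (H.π_diam W x)
      have h2 := H.π_lipschitz W (g y) x
      rw [dist_comm] at h2
      have h3 := mul_le_mul_of_nonneg_left hy hK0
      linarith
    exact ⟨y, fun V hV => ⟨hmove V _ (singleton_nonempty _) (hx V hV).1, fun W hW =>
      hmove W _ (H.ρset_nonempty V W hW) ((hx V hV).2 W hW)⟩⟩
  case un =>
    intro κ
    obtain ⟨θ, hθ⟩ := H.uniqueness κ
    obtain ⟨S, hS⟩ := hg θ
    -- Points at distance at least `S + 1` cannot have images at distance at most `θ`.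
    refine ⟨S + 1, fun y y' hy => hθ _ _ ?_⟩
    by_contra! hlt
    linarith [hS y y' hlt.le]

end Transfer

end MorseHHS

/-! ### Conclusion. -/

theorem corollary5p7 {X : Type u} {Y : Type v} [MetricSpace X] [MetricSpace Y]
    [ProperSpace X] [ProperSpace Y]
    (hX : MorseHHS.IsGeodesicSpace X) (hY : MorseHHS.IsGeodesicSpace Y)
    (p : X) (q : Y)
    (hXc : MorseHHS.IsMorseCenterSpace p) (hYc : MorseHHS.IsMorseCenterSpace q)
    (hXs : MorseHHS.HasSmallCrossRatio p) (hYs : MorseHHS.HasSmallCrossRatio q)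
    (h : MorseHHS.MorseBoundary p ≃ₜ MorseHHS.MorseBoundary q)
    (h_stable : MorseHHS.IsTwoStable h) (h_mobius : MorseHHS.IsQuasiMobius h)
    (h_symm_stable : MorseHHS.IsTwoStable h.symm) (h_symm_mobius : MorseHHS.IsQuasiMobius h.symm)
    (hHHS : Nonempty (MorseHHS.HHSStructure.{u, w, z} X)) :
    Nonempty (MorseHHS.HHSStructure.{v, w, z} Y) := by
  obtain ⟨N, K, -, hc⟩ := hXc
  obtain ⟨M, L, -, hc'⟩ := hYc
  obtain ⟨N', hN⟩ := h_stable N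
  obtain ⟨M', hM⟩ := h_symm_stable M
  obtain ⟨f, hf⟩ := MorseHHS.exists_center_map hY hc hN
  obtain ⟨g, hg⟩ := MorseHHS.exists_center_map hX hc' hM
  obtain ⟨D, hD⟩ := MorseHHS.exists_dist_inverse_le hX hY h.symm_apply_apply h_symm_stable
    h_symm_mobius hN hf hg
  obtain ⟨D', hD'⟩ := MorseHHS.exists_dist_inverse_le hY hX h.apply_symm_apply h_stable
    h_mobius hM hg hf
  obtain ⟨A, hA⟩ := h_symm_mobius.exists_dist_map_le hY hX h_symm_stable hg 1
  obtain ⟨H⟩ := hHHS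
  have : Nonempty X := ⟨p⟩
  -- Closeness of `g ∘ f` to the identity makes `g` coarsely onto. Closeness of `f ∘ g` to the
  -- identity, with the control on `f` at scale `R`, bounds `dist y y'` in terms of the images.
  refine H.nonempty_of_coarseEquiv g (MorseHHS.dist_map_le_of_geodesic hY hA)
    (fun x => ⟨f x, hD x⟩) fun R => ?_
  obtain ⟨S, hS⟩ := h_mobius.exists_dist_map_le hX hY h_stable hf R
  refine ⟨D' + S + D', fun y y' hyy => ?_⟩
  have h1 := dist_triangle4 y (f (g y)) (f (g y')) y'
  have h2 := hD' y'
  rw [dist_comm] at h2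
  linarith [hD' y, hS _ _ hyy]
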